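/- Let $d\ge 0$, $a<b$ real, and let $\mathcal M=\mathcal M(\mathbb R^d\times[a,b))$ be the space of finite signed Borel measures, regarded as the dual of $C_0(\mathbb R^d\times[a,b))$ (continuous functions vanishing as $|x|\to\infty$ and as $t\to b$, not necessarily at $t=a$). Let $\gamma\ge 0$ be a bounded continuous function on $\mathbb R^{d+1}$ and, for $(x,s)\in\mathbb R^{d+1}$, let $K(x,s;dz,dw)$ be a Lévy measure on $\mathbb R^{d+1}$ carried by $\mathbb R^d\times[0,\infty)$ with $\int_{w\le 1} w\,K(x,s;dz,dw)<\infty$, such that $(x,s)\mapsto\int g(z,w)\,K(x,s;dz,dw)$ is bounded and continuous for every bounded measurable $g$ vanishing near the origin. Put $H(x,s;v)=K(x,s;\mathbb R^d\times(v,\infty))$ for $v>0$ and assume $\int_0^1\sup_{(x,s)}H(x,s;v)\,dv<\infty$. For $f\in C_0(\mathbb R^d\times[a,b))$, extended by $0$ to $t\ge b$, let $$\Psi f(x,s)=f(x,s)\gamma(x,s)+\int_0^\infty f(x,s+v)H(x,s;v)\,dv .$$ Then $\Psi$ is a bounded operator on $C_0(\mathbb R^d\times[a,b))$, and its adjoint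 on $\mathcal M$ is $$\Psi^*h(dy,dt)=\gamma(y,t)\,h(dy,dt)+dt\int_{a\le\sigma<t}h(dy,d\sigma)\,H(y,\sigma;t-\sigma).$$ Suppose that $\gamma(y,t)=\gamma(y)$ and $H(y,t;v)=H(y;v)$ do not depend on $t$ and that, for every $y$, $\gamma(y)$ and $H(y;\cdot)$ do not both vanish. Then: 1. $\Psi^*:\mathcal M\to\mathcal M$ is one-to-one. 2. For every $y$ there is a subordinator with drift $\gamma(y)$ and Lévy tail $H(y;\cdot)$. Its renewal measure $V(y,\cdot)$, i.e. $V(y,B)=\int_0^\infty P(S^y_r\in B)\,dr$ with $S^y$ that subordinator, depends measurably on $y$ and satisfies, for all $\lambda>0$, $$\int_{[0,\infty)}e^{-\lambda t}\,V(y,dt)=\frac1\lambda\,\frac{1}{\gamma(y)+\hat H(y,\lambda)},\qquad \hat H(y,\lambda)=\int_0^\infty e^{-\lambda v}H(y;v)\,dv .$$ 3. For every $h$ in the range of $\Psi^*$, the convolution $(V\star_t h)(dy,dt)=\int_{s\in[a,b)}V(y,dt-s)\,h(dy,ds)$, restricted to $\mathbb R^d\times[a,b)$, is a finite signed measure (the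 convolutions of $V$ with $h^+$ and with $h^-$ are both finite), and $$(\Psi^*)^{-1}h=\frac{d}{dt}\,(V\star_t h).$$ That is, for every $g\in\mathcal M$, $\Psi^*g=h$ if and only if $g$ is the distributional $t$-derivative of $V\star_t h$ in the sense that $$\int\varphi\,dg=-\int\partial_t\varphi\,d(V\star_t h)\qquad\text{for all }\varphi\in C_c^\infty(\mathbb R^d\times(-\infty,b)).$$ -/

import Mathlib

open MeasureTheory Set Filter Topology
open scoped ENNReal ZeroAtInfty ContDiff

namespace CTRW

/-- The spatial variable lives in `ℝ^d`. -/
abbrev Space (d : ℕ) : Type := EuclideanSpace ℝ (Fin d)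

/-- The space-time slab `ℝ^d × [a, b)`. Continuous functions on it that vanish at infinity vanish
as `|x| → ∞` and as `t → b`, but not necessarily at `t = a`. -/
abbrev Slab (d : ℕ) (a b : ℝ) : Type := Space d × Ico a b

noncomputable section

/-- The inclusion `ℝ^d × [a, b) → ℝ^d × ℝ`. -/
def Slab.incl {d : ℕ} {a b : ℝ} (p : Slab d a b) : Space d × ℝ := (p.1, (p.2 : ℝ))

/-- `H(x, s; v) = K(x, s; ℝ^d × (v, ∞))`. -/
def tail {d : ℕ} (K : Space d × ℝ → Measure (Space d × ℝ)) (p : Space d × ℝ) (v : ℝ) : ℝ≥0∞ :=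
  K p {q | v < q.2}

/-- The standing conditions on the time drift `γ` and the jump kernel `K(x, s; dz, dw)` of the
space-time process `(A_r, D_r)` with nondecreasing time component. -/
structure IsCoefficients {d : ℕ} (γ : Space d × ℝ → ℝ)
    (K : Space d × ℝ → Measure (Space d × ℝ)) : Prop where
  drift_continuous : Continuous γ
  drift_nonneg : ∀ p, 0 ≤ γ p
  drift_bounded : ∃ C, ∀ p, γ p ≤ C
  /-- every `K(x, s; ·)` is a Lévy measure on `ℝ^(d+1)` … -/
  jump_zero : ∀ p, K p {0} = 0
  jump_levy : ∀ p, ∫⁻ q, ENNReal.ofReal (min 1 (‖q.1‖ ^ 2 + q.2 ^ 2)) ∂(K p) < ⊤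
  /-- … carried by `ℝ^d × [0, ∞)` … -/
  jump_nonneg : ∀ p, K p {q | q.2 < 0} = 0
  /-- … whose time jumps have finite variation. -/
  jump_finite_variation : ∀ p, ∫⁻ q in {q | q.2 ≤ 1}, ENNReal.ofReal q.2 ∂(K p) < ⊤
  /-- `K g ∈ C_b` for bounded measurable `g` that vanish in a neighbourhood of the origin. -/
  jump_continuous : ∀ g : Space d × ℝ → ℝ, Measurable g → (∃ C, ∀ q, |g q| ≤ C) →
    (∀ᶠ q in 𝓝 0, g q = 0) →
      Continuous (fun p => ∫ q, g q ∂(K p)) ∧ ∃ C, ∀ p, |∫ q, g q ∂(K p)| ≤ C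
  /-- `∫₀¹ sup_{(x, s)} H(x, s; v) dv < ∞`. -/
  tail_uniform : ∫⁻ v in Ioc (0 : ℝ) 1, (⨆ p, tail K p v) < ⊤

/-- Extension by zero from `ℝ^d × [a, b)` to `ℝ^d × ℝ`. -/
def zeroExt {d : ℕ} {a b : ℝ} (f : Slab d a b → ℝ) (q : Space d × ℝ) : ℝ :=
  open Classical in if h : q.2 ∈ Ico a b then f (q.1, ⟨q.2, h⟩) else 0

/-- `Ψ f (x, s) = f(x, s) γ(x, s) + ∫_{v > 0} f(x, s + v) H(x, s; v) dv`,
where `f(x, t) = 0` for `t ≥ b`. -/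
def psi {d : ℕ} {a b : ℝ} (γ : Space d × ℝ → ℝ) (K : Space d × ℝ → Measure (Space d × ℝ))
    (f : Slab d a b → ℝ) (p : Slab d a b) : ℝ :=
  f p * γ p.incl + ∫ v in Ioi (0 : ℝ), zeroExt f (p.1, p.2 + v) * (tail K p.incl v).toReal

/-- A finite measure as a signed measure (junk value `0` for an infinite measure). -/
def toSigned {α : Type*} [MeasurableSpace α] (μ : Measure α) : SignedMeasure α :=
  open Classical in if h : IsFiniteMeasure μ then @Measure.toSignedMeasure α _ μ h else 0

/-- Convolution in the time variable, restricted to the slab: for `κ(y, s; ·)` a family of measures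
on `ℝ` and a measure `ν` on the slab, the measure
`B ↦ ∫ ν(dy, ds) κ(y, s; {u : (y, s + u) ∈ B})` on `ℝ^d × [a, b)`. -/
def timeConv {d : ℕ} {a b : ℝ} (κ : Slab d a b → Measure ℝ) (ν : Measure (Slab d a b)) :
    Measure (Slab d a b) :=
  (ν.bind fun p => (κ p).map fun u => (p.1, (p.2 : ℝ) + u)).comap Slab.incl

/-- The action of `Ψ*` on (positive) measures:
`Ψ*ν(dy, dt) = γ(y, t) ν(dy, dt) + dt ∫_{a ≤ σ < t} ν(dy, dσ) H(y, σ; t - σ)`. -/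
def psiStarPos {d : ℕ} {a b : ℝ} (γ : Space d × ℝ → ℝ) (K : Space d × ℝ → Measure (Space d × ℝ))
    (ν : Measure (Slab d a b)) : Measure (Slab d a b) :=
  ν.withDensity (fun p => ENNReal.ofReal (γ p.incl)) +
    timeConv (fun p => (volume.restrict (Ioi (0 : ℝ))).withDensity (tail K p.incl)) ν

/-- `Ψ*` on the space of finite signed measures on `ℝ^d × [a, b)`. -/
def psiStar {d : ℕ} {a b : ℝ} (γ : Space d × ℝ → ℝ) (K : Space d × ℝ → Measure (Space d × ℝ))
    (h : SignedMeasure (Slab d a b)) : SignedMeasure (Slab d a b) :=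
  toSigned (psiStarPos γ K h.toJordanDecomposition.posPart) -
    toSigned (psiStarPos γ K h.toJordanDecomposition.negPart)

/-- `V ⋆_t ν` for a positive measure `ν` on the slab. -/
def renewalConvPos {d : ℕ} {a b : ℝ} (V : Space d → Measure ℝ) (ν : Measure (Slab d a b)) :
    Measure (Slab d a b) :=
  timeConv (fun p => V p.1) ν

/-- `V ⋆_t h` for a finite signed measure `h` on the slab. -/
def renewalConv {d : ℕ} {a b : ℝ} (V : Space d → Measure ℝ) (h : SignedMeasure (Slab d a b)) :
    SignedMeasure (Slab d a b) :=
  toSigned (renewalConvPos V h.toJordanDecomposition.posPart) -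
    toSigned (renewalConvPos V h.toJordanDecomposition.negPart)

/-- `d/dt μ = g` in the sense of distributions on `ℝ^d × (-∞, b)`, where measures on
`ℝ^d × [a, b)` are extended by zero to `t < a`. Equivalently, `d/dt` is the adjoint of `-∂/∂t` on
functions on `ℝ^d × [a, b)` that vanish near `b` but not necessarily at `a`. -/
def IsTimeDerivative {d : ℕ} {a b : ℝ} (μ g : SignedMeasure (Slab d a b)) : Prop :=
  ∀ φ : Space d × ℝ → ℝ, ContDiff ℝ ∞ φ → HasCompactSupport φ → tsupport φ ⊆ {q | q.2 < b} →
    ∫ᵛ p, φ p.incl ∂<•g = -∫ᵛ p, deriv (fun t => φ (p.1, t)) p.2 ∂<•μ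

/-- `(π r)_{r ≥ 0}` is the family of one-dimensional laws of the (unkilled) subordinator with drift
`c` and Lévy measure `ν`: a convolution semigroup of probability measures on `[0, ∞)` with Laplace
exponent `c λ + ∫ (1 - e^{-λ w}) ν(dw)`. -/
structure IsSubordinator (c : ℝ) (ν : Measure ℝ) (π : ℝ → Measure ℝ) : Prop where
  drift_nonneg : 0 ≤ c
  levy_support : ν (Iic 0) = 0
  levy_finite : ∫⁻ w, ENNReal.ofReal (min 1 w) ∂ν < ⊤
  isProbability : ∀ r, 0 ≤ r → IsProbabilityMeasure (π r)
  nonneg : ∀ r, 0 ≤ r → π r (Iio 0) = 0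
  semigroup : ∀ r s, 0 ≤ r → 0 ≤ s → π (r + s) = (π r).conv (π s)
  laplace : ∀ r l, 0 ≤ r → 0 < l → ∫ x, Real.exp (-l * x) ∂(π r) =
    Real.exp (-r * (c * l + ∫ w in Ioi (0 : ℝ), (1 - Real.exp (-l * w)) ∂ν))

/-- `V` is the renewal (potential) measure `∫₀^∞ P(S_r ∈ ·) dr` of the subordinator `S` with
drift `c` and Lévy tail `H(v) = ν((v, ∞))`, `v > 0`. -/
def IsRenewalMeasure (c : ℝ) (H : ℝ → ℝ) (V : Measure ℝ) : Prop :=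
  ∃ (ν : Measure ℝ) (π : ℝ → Measure ℝ), IsSubordinator c ν π ∧
    (∀ v, 0 < v → ν (Ioi v) = ENNReal.ofReal (H v)) ∧
    ∀ B, MeasurableSet B → V B = ∫⁻ r in Ici (0 : ℝ), π r B

end

end CTRW

/-! Since the coefficients do not depend on time, `Ψ*` acts over a fixed `y` as convolution in time
with `κ_y = γ(y) δ₀ + H(y; v) dv`, whose Laplace transform is `γ(y) + Ĥ(y, λ)`. The renewal measure
`V(y, ·)` has transform `1 / (λ (γ(y) + Ĥ(y, λ)))`. The product is `1 / λ`, so `V(y, ·) * κ_y` is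
Lebesgue measure on `[0, ∞)` (`IsRenewalMeasure.conv_eq`). Hence `V ⋆ Ψ*g` is the time primitive of
`g` (`renewalConvPos_psiStarPos`), and `d/dt` recovers `g`. Truncation at `b` does no harm: all
kernels live on `[0, ∞)`, so mass that has left the slab never returns. Time derivatives are unique
(`IsTimeDerivative.unique`), which gives both injectivity and the characterisation of the preimage.

Convolution identities are proved for positive measures with values in `[0, ∞]`, where no
integrability is needed. If `h = Ψ*g`, minimality of the Jordan decomposition gives `h± ≤ Ψ*g±`, so
`V ⋆ h±` is dominated by the time primitive of `g±` and is finite.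

Subordinators are built through `x ↦ exp (-x)`, which sends `[0, ∞)` to the compact `[0, 1]`, sums
to products and Laplace transforms to moments. Compound Poisson laws with truncated jumps have a
weak limit by compactness, and the limit has no mass at `0`. With Weierstrass approximation, the
same substitution shows that Laplace transforms determine measures and their measurability in a
parameter.

That `Ψ` preserves `C₀` is dominated convergence: the supremum of the tails is integrable on `(0, b
- a]`. -/

namespace CTRW

/-! ### Laplace transforms: uniqueness and measurability -/

section Laplace

/-- A family of finite measures on `[0, 1]` is measurable if its moments are. -/
theorem measurable_of_measurable_integral_pow {ι : Type*} [MeasurableSpace ι]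
    (μ : ι → Measure unitInterval) [∀ i, IsFiniteMeasure (μ i)]
    (h : ∀ k : ℕ, Measurable fun i => ∫ x, (x : ℝ) ^ k ∂(μ i)) : Measurable μ := by
  have hint : ∀ (f : C(unitInterval, ℝ)) i, Integrable f (μ i) := fun f i =>
    (BoundedContinuousFunction.mkOfCompact f).integrable (μ i)
  have hpow : ∀ (k : ℕ) i, Integrable (fun x : unitInterval => (x : ℝ) ^ k) (μ i) := fun k i =>
    hint ⟨fun x => (x : ℝ) ^ k, by fun_prop⟩ i
  have hpoly : ∀ p : Polynomial ℝ, Measurable fun i => ∫ x : unitInterval, p.eval (x : ℝ) ∂(μ i) := by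
    intro p
    have : ∀ i, ∫ x : unitInterval, p.eval (x : ℝ) ∂(μ i)
        = ∑ k ∈ Finset.range (p.natDegree + 1), p.coeff k * ∫ x, (x : ℝ) ^ k ∂(μ i) := by
      intro i
      simp_rw [Polynomial.eval_eq_sum_range]
      rw [integral_finsetSum _ fun k _ => (hpow k i).const_mul _]
      simp_rw [integral_const_mul]
    simp_rw [this]
    exact Finset.measurable_fun_sum _ fun k _ => (h k).const_mul _
  have hcont : ∀ f : C(unitInterval, ℝ), Measurable fun i => ∫ x, f x ∂(μ i) := by
    intro f
    -- Weierstrass approximation: integrals of continuous functions are limits of combinations of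
    -- moments.
    have hp : ∀ n : ℕ, ∃ p : Polynomial ℝ,
        ‖p.toContinuousMapOn (Icc 0 1) - f‖ < 1 / ((n : ℝ) + 1) := fun n =>
      exists_polynomial_near_continuousMap 0 1 f _ (by positivity)
    choose p hp using hp
    refine measurable_of_tendsto_metrizable (fun n => hpoly (p n)) ?_
    rw [tendsto_pi_nhds]
    intro i
    refine tendsto_integral_of_dominated_convergence (fun _ => ‖f‖ + 1) (fun n => ?_)
      (integrable_const _) (fun n => ?_) ?_
    · exact (hint ((p n).toContinuousMapOn (Icc 0 1)) i).aestronglyMeasurable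
    · refine .of_forall fun x => ?_
      have h1 := (ContinuousMap.norm_coe_le_norm ((p n).toContinuousMapOn (Icc 0 1) - f) x).trans
        (hp n).le
      have h2 := ContinuousMap.norm_coe_le_norm f x
      have h3 : (1 : ℝ) / (n + 1) ≤ 1 := by
        rw [div_le_one (by positivity)]; linarith [n.cast_nonneg (α := ℝ)]
      have h4 : ‖(p n).eval (x : ℝ)‖ ≤ ‖(p n).eval (x : ℝ) - f x‖ + ‖f x‖ :=
        norm_le_norm_sub_add _ _
      have h5 : ‖(p n).eval (x : ℝ) - f x‖ ≤ 1 / (n + 1) := h1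
      linarith
    · refine .of_forall fun x => ?_
      rw [tendsto_iff_norm_sub_tendsto_zero]
      refine squeeze_zero (fun _ => norm_nonneg _) (fun n => ?_)
        tendsto_one_div_add_atTop_nhds_zero_nat
      exact (ContinuousMap.norm_coe_le_norm ((p n).toContinuousMapOn (Icc 0 1) - f) x).trans
        (hp n).le
  have hclosed : ∀ s : Set unitInterval, IsClosed s → Measurable fun i => μ i s := by
    intro s hs
    have hδ : ∀ n : ℕ, (0 : ℝ) < 1 / (n + 1) := fun n => by positivity
    refine measurable_of_tendsto_metrizable
      (f := fun n i => ∫⁻ x, (thickenedIndicator (hδ n) s x : ℝ≥0∞) ∂(μ i)) (fun n => ?_) ?_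
    · have h1 : ∀ i, ∫⁻ x, (thickenedIndicator (hδ n) s x : ℝ≥0∞) ∂(μ i) =
          ENNReal.ofReal (∫ x, (thickenedIndicator (hδ n) s x : ℝ) ∂(μ i)) := by
        intro i
        rw [ofReal_integral_eq_lintegral_ofReal]
        · simp
        · exact hint ⟨fun x => (thickenedIndicator (hδ n) s x : ℝ), by fun_prop⟩ i
        · exact .of_forall fun x => NNReal.coe_nonneg _
      simp_rw [h1]
      exact (hcont ⟨fun x => (thickenedIndicator (hδ n) s x : ℝ), by fun_prop⟩).ennreal_ofReal
    · rw [tendsto_pi_nhds]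
      intro i
      exact tendsto_lintegral_thickenedIndicator_of_isClosed _ hs hδ
        tendsto_one_div_add_atTop_nhds_zero_nat
  refine Measurable.measure_of_isPiSystem (S := {s | IsClosed s})
    (by rw [← borel_eq_generateFrom_isClosed]; exact BorelSpace.measurable_eq) isPiSystem_isClosed
    hclosed (hclosed _ isClosed_univ)

/-- The Laplace transform of a measure on the line, with values in `[0, ∞]`. -/
noncomputable def lap (μ : Measure ℝ) (l : ℝ) : ℝ≥0∞ := ∫⁻ x, ENNReal.ofReal (Real.exp (-l * x)) ∂μ

/-- `x ↦ exp (-x)` as a map from `[0, ∞)` to `[0, 1]`, extended to the line. -/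
noncomputable def expNeg (x : ℝ) : unitInterval :=
  ⟨Real.exp (-max x 0), (Real.exp_pos _).le, Real.exp_le_one_iff.2 (by simp)⟩

@[fun_prop]
theorem measurable_expNeg : Measurable expNeg := by
  unfold expNeg
  fun_prop

theorem coe_expNeg_of_nonneg {x : ℝ} (hx : 0 ≤ x) : (expNeg x : ℝ) = Real.exp (-x) := by
  simp [expNeg, hx]

theorem ae_nonneg_of_measure_Iio {μ : Measure ℝ} (h : μ (Iio 0) = 0) : ∀ᵐ x ∂μ, 0 ≤ x := by
  rw [ae_iff]; simpa [Set.Iio] using h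

/-- A family of measures on `[0, ∞)` is measurable if its Laplace transforms are. -/
theorem measurable_of_measurable_lap {ι : Type*} [MeasurableSpace ι] {μ : ι → Measure ℝ}
    (h0 : ∀ i, μ i (Iio 0) = 0) (hfin : ∀ i, lap (μ i) 1 ≠ ⊤)
    (h : ∀ l, 0 < l → Measurable fun i => lap (μ i) l) : Measurable μ := by
  set τ : ι → Measure ℝ := fun i => (μ i).withDensity fun x => ENNReal.ofReal (Real.exp (-x))
    with hτ
  have hτfin : ∀ i, IsFiniteMeasure (τ i) := fun i =>
    isFiniteMeasure_withDensity (by simpa [lap] using hfin i)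
  -- The weight `exp (-x)` makes the measures finite and turns the `k`-th moment into the transform
  -- at `k + 1`, which is positive even for `k = 0`.
  have hσ : Measurable fun i => (τ i).map expNeg := by
    refine measurable_of_measurable_integral_pow _ fun k => ?_
    have : ∀ i, ∫ x : unitInterval, (x : ℝ) ^ k ∂((τ i).map expNeg) =
        (lap (μ i) (k + 1)).toReal := by
      intro i
      rw [integral_map (by fun_prop) (by fun_prop),
        integral_eq_lintegral_of_nonneg_ae (.of_forall fun x => pow_nonneg (expNeg x).2.1 _)
          (by fun_prop), hτ, lintegral_withDensity_eq_lintegral_mul _ (by fun_prop) (by fun_prop)]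
      congr 1
      refine lintegral_congr_ae ?_
      filter_upwards [ae_nonneg_of_measure_Iio (h0 i)] with x hx
      rw [Pi.mul_apply, coe_expNeg_of_nonneg hx, ← ENNReal.ofReal_mul (Real.exp_pos _).le,
        ← Real.exp_nat_mul, ← Real.exp_add]
      congr 2
      ring
    simp_rw [this]
    exact (h _ (by positivity)).ennreal_toReal
  refine Measure.measurable_of_measurable_coe _ fun s hs => ?_
  -- At `y = exp (-x)`, `-log y` returns `x` and `y⁻¹` removes the weight.
  set G : unitInterval → ℝ≥0∞ := fun y =>
    (s.indicator 1 (-Real.log y)) * ENNReal.ofReal (y : ℝ)⁻¹ with hG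
  have hGm : Measurable G := by
    refine Measurable.mul ?_ (by fun_prop)
    exact (measurable_one.indicator hs).comp (by fun_prop)
  have : ∀ i, μ i s = ∫⁻ y, G y ∂((τ i).map expNeg) := by
    intro i
    rw [lintegral_map hGm (by fun_prop), hτ,
      lintegral_withDensity_eq_lintegral_mul _ (by fun_prop) (by fun_prop), ← lintegral_indicator_one hs]
    refine lintegral_congr_ae ?_
    filter_upwards [ae_nonneg_of_measure_Iio (h0 i)] with x hx
    rw [Pi.mul_apply, hG]
    simp only
    rw [coe_expNeg_of_nonneg hx, Real.log_exp, neg_neg, mul_left_comm,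
      ← ENNReal.ofReal_mul (Real.exp_pos _).le, mul_inv_cancel₀ (Real.exp_ne_zero _)]
    simp
  simp_rw [this]
  exact (Measure.measurable_lintegral hGm).comp hσ

/-- Measures on `[0, ∞)` are determined by their Laplace transforms. -/
theorem ext_of_lap {μ ν : Measure ℝ} (hμ : μ (Iio 0) = 0) (hν : ν (Iio 0) = 0)
    (hfin : lap μ 1 ≠ ⊤) (h : ∀ l, 0 < l → lap μ l = lap ν l) : μ = ν := by
  -- The pair is a family over `Bool` with the trivial σ-algebra. Equal transforms are constant in
  -- the index, hence measurable; so the family itself is measurable, which forces it to be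
  -- constant.
  let _ : MeasurableSpace Bool := ⊥
  have hb : Measurable fun i : Bool => cond i μ ν := by
    refine measurable_of_measurable_lap (fun i => by cases i <;> simpa) (fun i => ?_)
      fun l hl => ?_
    · cases i
      · simpa [← h 1 one_pos] using hfin
      · simpa using hfin
    · have : (fun i : Bool => lap (cond i μ ν) l) = fun _ => lap μ l := by
        funext i; cases i <;> simp [h l hl]
      rw [this]
      exact measurable_const
  ext s hs
  have hs' := (Measure.measurable_coe hs).comp hb
  have h1 := hs' (measurableSet_singleton (μ s))
  rcases MeasurableSpace.measurableSet_bot_iff.1 h1 with h2 | h2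
  · have : true ∈ (∅ : Set Bool) := h2 ▸ (by simp)
    simp at this
  · have : false ∈ (univ : Set Bool) := mem_univ _
    rw [← h2] at this
    simpa using this.symm

theorem lap_conv (μ ν : Measure ℝ) [SFinite ν] (l : ℝ) :
    lap (μ.conv ν) l = lap μ l * lap ν l := by
  unfold lap
  rw [Measure.lintegral_conv (by fun_prop)]
  simp_rw [mul_add, Real.exp_add, ENNReal.ofReal_mul (Real.exp_pos _).le]
  rw [← lintegral_mul_const _ (by fun_prop)]
  simp_rw [lintegral_const_mul _ (show Measurable fun y : ℝ => ENNReal.ofReal (Real.exp (-l * y)) by fun_prop)]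

theorem conv_Iio_zero {μ ν : Measure ℝ} [SFinite μ] [SFinite ν] (hμ : μ (Iio 0) = 0) (hν : ν (Iio 0) = 0) :
    (μ.conv ν) (Iio 0) = 0 := by
  rw [← lintegral_indicator_one measurableSet_Iio,
    Measure.lintegral_conv (measurable_one.indicator measurableSet_Iio)]
  refine (lintegral_congr_ae (g := fun _ => 0) ?_).trans (by simp)
  filter_upwards [ae_nonneg_of_measure_Iio hμ] with x hx
  refine (lintegral_congr_ae (g := fun _ => 0) ?_).trans (by simp)
  filter_upwards [ae_nonneg_of_measure_Iio hν] with y hy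
  simp [add_nonneg hx hy]

theorem lap_eq_ofReal_integral {μ : Measure ℝ} [IsFiniteMeasure μ] (h : μ (Iio 0) = 0) {l : ℝ}
    (hl : 0 < l) : lap μ l = ENNReal.ofReal (∫ x, Real.exp (-l * x) ∂μ) := by
  rw [lap, ofReal_integral_eq_lintegral_ofReal _ (.of_forall fun x => (Real.exp_pos _).le)]
  refine Integrable.of_bound (C := 1) (by fun_prop) ?_
  filter_upwards [ae_nonneg_of_measure_Iio h] with x hx
  rw [Real.norm_of_nonneg (Real.exp_pos _).le, Real.exp_le_one_iff]
  nlinarith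

end Laplace

/-! ### Compound Poisson laws on `[0, 1]` under multiplication -/

section CompoundPoisson

theorem measurable_coe_rpow (l : ℝ) : Measurable fun x : unitInterval => (x : ℝ) ^ l :=
  measurable_subtype_coe.pow_const l

/-- Powers of a measure on `[0, 1]` for multiplicative convolution. -/
noncomputable def mconvPow (ν : Measure unitInterval) : ℕ → Measure unitInterval
  | 0 => Measure.dirac 1
  | n + 1 => ν.mconv (mconvPow ν n)

instance isFiniteMeasure_mconvPow (ν : Measure unitInterval) [IsFiniteMeasure ν] (n : ℕ) :
    IsFiniteMeasure (mconvPow ν n) := by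
  induction n with
  | zero => unfold mconvPow; infer_instance
  | succ n ih => unfold mconvPow; infer_instance

theorem lintegral_mconvPow (ν : Measure unitInterval) [IsFiniteMeasure ν]
    {F : unitInterval → ℝ≥0∞} (hF : Measurable F) (h1 : F 1 = 1)
    (hmul : ∀ x y, F (x * y) = F x * F y) (n : ℕ) :
    ∫⁻ x, F x ∂(mconvPow ν n) = (∫⁻ x, F x ∂ν) ^ n := by
  induction n with
  | zero => simp [mconvPow, lintegral_dirac' _ hF, h1]
  | succ n ih =>
    rw [mconvPow, Measure.lintegral_mconv hF]
    simp_rw [hmul, lintegral_const_mul _ hF, ih]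
    rw [lintegral_mul_const _ hF, pow_succ']

/-- The compound Poisson law on `[0, 1]` with jump measure `ν`. -/
noncomputable def compoundPoisson (ν : Measure unitInterval) : Measure unitInterval :=
  Measure.sum fun n : ℕ => ENNReal.ofReal (Real.exp (-ν.real univ) / n.factorial) • mconvPow ν n

/-- A multiplicative `F` integrates against the `n`-th convolution power to the `n`-th power of its
integral, so the sum is an exponential series. -/
theorem lintegral_compoundPoisson (ν : Measure unitInterval) [IsFiniteMeasure ν]
    {F : unitInterval → ℝ≥0∞} (hF : Measurable F) (h1 : F 1 = 1)
    (hmul : ∀ x y, F (x * y) = F x * F y) (hfin : ∫⁻ x, F x ∂ν ≠ ⊤) :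
    ∫⁻ x, F x ∂(compoundPoisson ν) =
      ENNReal.ofReal (Real.exp ((∫⁻ x, F x ∂ν).toReal - ν.real univ)) := by
  set A := (∫⁻ x, F x ∂ν).toReal with hA
  have hA0 : 0 ≤ A := ENNReal.toReal_nonneg
  have hs : HasSum (fun n : ℕ => Real.exp (-ν.real univ) / n.factorial * A ^ n)
      (Real.exp (A - ν.real univ)) := by
    have h := (NormedSpace.expSeries_div_hasSum_exp A).mul_left (Real.exp (-ν.real univ))
    rw [← Real.exp_eq_exp_ℝ, ← Real.exp_add, neg_add_eq_sub] at h
    have e : (fun n : ℕ => Real.exp (-ν.real univ) / n.factorial * A ^ n) =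
        fun n : ℕ => Real.exp (-ν.real univ) * (A ^ n / n.factorial) := by
      funext n
      ring
    rw [e]
    exact h
  rw [compoundPoisson, lintegral_sum_measure, ← hs.tsum_eq,
    ENNReal.ofReal_tsum_of_nonneg (fun n => by positivity) hs.summable]
  refine tsum_congr fun n => ?_
  rw [lintegral_smul_measure, lintegral_mconvPow ν hF h1 hmul, ENNReal.ofReal_mul (by positivity),
    ENNReal.ofReal_pow hA0, hA, ENNReal.ofReal_toReal hfin, smul_eq_mul]

/-- `exp (-Y)` for a compound Poisson variable `Y` with drift `c`. -/
theorem exists_probabilityMeasure_compoundPoisson {c : ℝ} (hc : 0 ≤ c) (ν : Measure unitInterval)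
    [IsFiniteMeasure ν] :
    ∃ P : ProbabilityMeasure unitInterval, ∀ l : ℝ, 0 < l → ∫ x, (x : ℝ) ^ l ∂(P : Measure unitInterval) =
      Real.exp (-(c * l + ∫ x : unitInterval, (1 - (x : ℝ) ^ l) ∂ν)) := by
  have hmass : compoundPoisson ν univ = 1 := by
    have h := lintegral_compoundPoisson ν (F := fun _ => 1) measurable_const rfl (by simp)
      (by simp)
    simpa [Measure.real] using h
  have hcp : IsProbabilityMeasure (compoundPoisson ν) := ⟨hmass⟩
  -- The drift becomes the deterministic factor `exp (-c)`.
  let P : Measure unitInterval := (Measure.dirac (expNeg c)).mconv (compoundPoisson ν)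
  have hP : IsProbabilityMeasure P := by
    infer_instance
  refine ⟨⟨P, hP⟩, fun l hl => ?_⟩
  set F : unitInterval → ℝ≥0∞ := fun x => ENNReal.ofReal ((x : ℝ) ^ l) with hF
  have hFm : Measurable F := (measurable_coe_rpow l).ennreal_ofReal
  have hF1 : F 1 = 1 := by simp [hF]
  have hmul : ∀ x y, F (x * y) = F x * F y := by
    intro x y
    simp only [hF]
    rw [← ENNReal.ofReal_mul (Real.rpow_nonneg x.2.1 _), ← Real.mul_rpow x.2.1 y.2.1]
    rfl
  have hint : Integrable (fun x : unitInterval => (x : ℝ) ^ l) ν :=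
    Integrable.of_bound (C := 1) (measurable_coe_rpow l).aestronglyMeasurable (.of_forall fun x => by
      rw [Real.norm_of_nonneg (Real.rpow_nonneg x.2.1 _)]
      exact Real.rpow_le_one x.2.1 x.2.2 hl.le)
  have hFν : ∫⁻ x, F x ∂ν = ENNReal.ofReal (∫ x : unitInterval, (x : ℝ) ^ l ∂ν) :=
    (ofReal_integral_eq_lintegral_ofReal hint (.of_forall fun x => Real.rpow_nonneg x.2.1 _)).symm
  have hFP : ∫⁻ x, F x ∂P =
      ENNReal.ofReal (Real.exp (-(c * l + ∫ x : unitInterval, (1 - (x : ℝ) ^ l) ∂ν))) := by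
    have hmx : Measurable fun x : unitInterval =>
        ∫⁻ y, F (x * y) ∂(compoundPoisson ν) := by
      simp_rw [hmul, lintegral_const_mul _ hFm]
      fun_prop
    rw [Measure.lintegral_mconv hFm, lintegral_dirac' _ hmx]
    simp_rw [hmul]
    rw [lintegral_const_mul _ hFm, lintegral_compoundPoisson ν hFm hF1 hmul (by simp [hFν]), hFν,
      ENNReal.toReal_ofReal (integral_nonneg fun x => Real.rpow_nonneg x.2.1 _)]
    simp only [hF]
    rw [coe_expNeg_of_nonneg hc, ← ENNReal.ofReal_mul (Real.rpow_nonneg (Real.exp_pos _).le _),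
      ← Real.exp_mul, ← Real.exp_add, integral_sub (integrable_const _) hint]
    congr 2
    simp
    ring
  change ∫ x, (x : ℝ) ^ l ∂P = _
  rw [integral_eq_lintegral_of_nonneg_ae (.of_forall fun x => Real.rpow_nonneg x.2.1 _)
    (measurable_coe_rpow l).aestronglyMeasurable, hFP, ENNReal.toReal_ofReal (Real.exp_pos _).le]

end CompoundPoisson

/-! ### Existence of subordinators with given drift and Lévy measure -/

section Subordinator

theorem one_sub_exp_nonneg {l w : ℝ} (hl : 0 < l) (hw : 0 < w) : 0 ≤ 1 - Real.exp (-l * w) := by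
  have : Real.exp (-l * w) ≤ 1 := Real.exp_le_one_iff.2 (by nlinarith [mul_pos hl hw])
  linarith

theorem one_sub_exp_le {l w : ℝ} (hw : 0 < w) :
    1 - Real.exp (-l * w) ≤ max 1 l * min 1 w := by
  rcases le_total 1 w with h | h
  · rw [min_eq_left h]
    have := le_max_left 1 l
    have := Real.exp_pos (-l * w)
    linarith
  · rw [min_eq_right h]
    have h1 := Real.add_one_le_exp (-l * w)
    have h2 := mul_le_mul_of_nonneg_right (le_max_right 1 l) hw.le
    linarith

variable {ν : Measure ℝ}

theorem integrableOn_one_sub_exp (hν : ∫⁻ w, ENNReal.ofReal (min 1 w) ∂ν < ⊤) {l : ℝ}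
    (hl : 0 < l) : IntegrableOn (fun w => 1 - Real.exp (-l * w)) (Ioi 0) ν := by
  refine ⟨by fun_prop, ?_⟩
  refine lt_of_le_of_lt ?_ (ENNReal.mul_lt_top (ENNReal.ofReal_lt_top (r := max 1 l)) hν)
  rw [← lintegral_const_mul _ (by fun_prop)]
  refine le_trans ?_ (setLIntegral_le_lintegral (Ioi 0) _)
  refine setLIntegral_mono (by fun_prop) fun w hw => ?_
  rw [← ENNReal.ofReal_mul (le_max_of_le_left zero_le_one),
    Real.enorm_of_nonneg (one_sub_exp_nonneg hl hw)]
  exact ENNReal.ofReal_le_ofReal (one_sub_exp_le hw)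

theorem measure_Ioi_lt_top_of_min (hν : ∫⁻ w, ENNReal.ofReal (min 1 w) ∂ν < ⊤) {ε : ℝ}
    (hε : 0 < ε) : ν (Ioi ε) < ⊤ := by
  have h := mul_meas_ge_le_lintegral (μ := ν) (f := fun w => ENNReal.ofReal (min 1 w))
    (by fun_prop) (ENNReal.ofReal (min 1 ε))
  have h1 : ν (Ioi ε) ≤ ν {w | ENNReal.ofReal (min 1 ε) ≤ ENNReal.ofReal (min 1 w)} :=
    measure_mono fun w hw => ENNReal.ofReal_le_ofReal (min_le_min_left _ (le_of_lt hw))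
  refine lt_of_le_of_lt h1 (ENNReal.lt_top_of_mul_ne_top_right (lt_of_le_of_lt h hν).ne ?_)
  simp [hε]

/-- `exp (-Y)` for an infinitely divisible variable `Y` with drift `c` and Lévy measure `ν`. -/
theorem exists_probabilityMeasure_limit {c : ℝ} (hc : 0 ≤ c)
    (hν : ∫⁻ w, ENNReal.ofReal (min 1 w) ∂ν < ⊤) :
    ∃ Q : ProbabilityMeasure unitInterval, ∀ l : ℝ, 0 < l →
      ∫ x, (x : ℝ) ^ l ∂(Q : Measure unitInterval) =
      Real.exp (-(c * l + ∫ w in Ioi (0 : ℝ), (1 - Real.exp (-l * w)) ∂ν)) := by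
  have hε : ∀ n : ℕ, (0 : ℝ) < 1 / (n + 1) := fun n => by positivity
  -- Discarding jumps of size at most `1 / (n + 1)` leaves a finite jump measure.
  let ρ : ℕ → Measure unitInterval := fun n => (ν.restrict (Ioi (1 / ((n : ℝ) + 1)))).map expNeg
  have hρ : ∀ n, IsFiniteMeasure (ρ n) := fun n => by
    have : IsFiniteMeasure (ν.restrict (Ioi (1 / ((n : ℝ) + 1)))) :=
      isFiniteMeasure_restrict.2 (measure_Ioi_lt_top_of_min hν (hε n)).ne
    infer_instance
  choose P hP using fun n => exists_probabilityMeasure_compoundPoisson hc (ρ n)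
  -- Probability measures on the compact `[0, 1]` form a compact space, so a limit along an
  -- ultrafilter exists without any tightness estimate.
  have hQ := (Ultrafilter.map P (hyperfilter ℕ)).le_nhds_lim
  set Q := (Ultrafilter.map P (hyperfilter ℕ)).lim
  have hQ' : Tendsto P (hyperfilter ℕ : Filter ℕ) (𝓝 Q) := hQ
  refine ⟨Q, fun l hl => ?_⟩
  have h1 := ProbabilityMeasure.tendsto_iff_forall_integral_tendsto.1 hQ'
    (BoundedContinuousFunction.mkOfCompact ⟨fun x : unitInterval => (x : ℝ) ^ l,
      continuous_subtype_val.rpow_const fun _ => .inr hl.le⟩)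
  refine tendsto_nhds_unique h1 (Tendsto.mono_left ?_ Nat.hyperfilter_le_atTop)
  have h2 : ∀ n, ∫ x : unitInterval, (1 - (x : ℝ) ^ l) ∂(ρ n) =
      ∫ w in Ioi (1 / ((n : ℝ) + 1)), (1 - Real.exp (-l * w)) ∂ν := by
    intro n
    have hm : Measurable fun x : unitInterval => 1 - (x : ℝ) ^ l :=
      measurable_const.sub (measurable_coe_rpow l)
    rw [integral_map measurable_expNeg.aemeasurable hm.aestronglyMeasurable]
    refine setIntegral_congr_fun measurableSet_Ioi fun w hw => ?_
    have hw0 : 0 ≤ w := ((hε n).trans hw).le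
    rw [coe_expNeg_of_nonneg hw0, ← Real.exp_mul]
    ring_nf
  have hU : ⋃ n : ℕ, Ioi (1 / ((n : ℝ) + 1)) = Ioi 0 := by
    ext w
    simp only [mem_iUnion, mem_Ioi]
    exact ⟨fun ⟨n, hn⟩ => (hε n).trans hn, fun hw => exists_nat_one_div_lt hw⟩
  have h3 : Tendsto (fun n : ℕ => ∫ w in Ioi (1 / ((n : ℝ) + 1)), (1 - Real.exp (-l * w)) ∂ν) atTop
      (𝓝 (∫ w in Ioi (0 : ℝ), (1 - Real.exp (-l * w)) ∂ν)) := by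
    rw [← hU]
    refine tendsto_setIntegral_of_monotone (fun n => measurableSet_Ioi) (fun m n hmn => ?_) ?_
    · exact Ioi_subset_Ioi (one_div_le_one_div_of_le (by positivity) (by gcongr))
    · rw [hU]
      exact integrableOn_one_sub_exp hν hl
  refine Tendsto.congr (fun n => ((hP n l hl).trans (by rw [h2 n])).symm) ?_
  exact (Real.continuous_exp.tendsto _).comp ((h3.const_add _).neg)

/-- The laws of a subordinator at a fixed time. -/
theorem exists_law_of_exponent {c : ℝ} (hc : 0 ≤ c)
    (hν : ∫⁻ w, ENNReal.ofReal (min 1 w) ∂ν < ⊤) :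
    ∃ π : Measure ℝ, IsProbabilityMeasure π ∧ π (Iio 0) = 0 ∧ ∀ l, 0 < l →
      ∫ x, Real.exp (-l * x) ∂π =
        Real.exp (-(c * l + ∫ w in Ioi (0 : ℝ), (1 - Real.exp (-l * w)) ∂ν)) := by
  obtain ⟨Q, hQ⟩ := exists_probabilityMeasure_limit hc hν
  have hε : ∀ n : ℕ, (0 : ℝ) < 1 / (n + 1) := fun n => by positivity
  have hε1 : ∀ n : ℕ, (1 : ℝ) / (n + 1) ≤ 1 := fun n => by
    rw [div_le_one (by positivity)]; linarith [n.cast_nonneg (α := ℝ)]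
  -- An atom of `Q` at `0` would be mass of `Y` at infinity. It is excluded by letting the power
  -- tend to `0`: `x ^ (1 / (n + 1))` tends to the indicator of `x ≠ 0`, while the integrals tend to
  -- `exp 0 = 1`.
  have h1 : Tendsto (fun n : ℕ => ∫ x, (x : ℝ) ^ ((1 : ℝ) / (n + 1)) ∂(Q : Measure unitInterval)) atTop
      (𝓝 (∫ x, ({0}ᶜ : Set unitInterval).indicator (fun _ => (1 : ℝ)) x ∂(Q : Measure unitInterval))) := by
    refine tendsto_integral_of_dominated_convergence (fun _ => 1)
      (fun n => (measurable_coe_rpow _).aestronglyMeasurable) (integrable_const _) (fun n => .of_forall fun x => ?_) (.of_forall fun x => ?_)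
    · rw [Real.norm_of_nonneg (Real.rpow_nonneg x.2.1 _)]
      exact Real.rpow_le_one x.2.1 x.2.2 (hε n).le
    · by_cases hx : x = 0
      · have : ∀ n : ℕ, ((x : ℝ)) ^ ((1 : ℝ) / (n + 1)) = 0 := fun n => by
          rw [hx]; exact Real.zero_rpow (hε n).ne'
        simp only [this]
        simp [hx]
      · have hx' : (x : ℝ) ≠ 0 := fun h => hx (Subtype.ext h)
        have := (Real.continuousAt_const_rpow hx' (b := 0)).tendsto.comp
          tendsto_one_div_add_atTop_nhds_zero_nat
        simpa [hx, Function.comp_def] using this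
  have h2 : Tendsto (fun n : ℕ => ∫ w in Ioi (0 : ℝ), (1 - Real.exp (-((1 : ℝ) / (n + 1)) * w)) ∂ν)
      atTop (𝓝 (∫ w in Ioi (0 : ℝ), (0 : ℝ) ∂ν)) := by
    refine tendsto_integral_of_dominated_convergence (fun w => 1 - Real.exp (-1 * w))
      (fun n => by fun_prop) (integrableOn_one_sub_exp hν one_pos) (fun n => ?_) ?_
    · filter_upwards [ae_restrict_mem measurableSet_Ioi] with w hw
      rw [Real.norm_of_nonneg (one_sub_exp_nonneg (hε n) hw)]
      have hw' : 0 < w := hw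
      have := hε1 n
      gcongr
    · refine .of_forall fun w => ?_
      have h : Continuous fun t : ℝ => 1 - Real.exp (-t * w) := by fun_prop
      simpa [Function.comp_def] using (h.tendsto 0).comp tendsto_one_div_add_atTop_nhds_zero_nat
  have h3 : Tendsto (fun n : ℕ => ∫ x, (x : ℝ) ^ ((1 : ℝ) / (n + 1)) ∂(Q : Measure unitInterval)) atTop
      (𝓝 1) := by
    simp_rw [fun n : ℕ => hQ _ (hε n)]
    have := (Real.continuous_exp.tendsto _).comp
      (((tendsto_one_div_add_atTop_nhds_zero_nat (𝕜 := ℝ)).const_mul c).add h2).neg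
    simpa [Function.comp_def] using this
  have h4 : (Q : Measure unitInterval).real {0}ᶜ = 1 := by
    have := tendsto_nhds_unique h1 h3
    rwa [integral_indicator_const _ (measurableSet_singleton _).compl, smul_eq_mul, mul_one]
      at this
  have h5 : ∀ᵐ x ∂(Q : Measure unitInterval), x ≠ 0 := by
    have : (Q : Measure unitInterval) {0}ᶜ = 1 := by
      rw [← ENNReal.ofReal_toReal (measure_ne_top (Q : Measure unitInterval) {0}ᶜ)]
      simp [← Measure.real_def, h4]
    exact (prob_compl_eq_zero_iff (measurableSet_singleton _).compl).2 this
  have hm : Measurable fun x : unitInterval => -Real.log x := by fun_prop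
  refine ⟨(Q : Measure unitInterval).map fun x : unitInterval => -Real.log x, Measure.isProbabilityMeasure_map hm.aemeasurable, ?_,
    fun l hl => ?_⟩
  · rw [Measure.map_apply hm measurableSet_Iio]
    refine measure_mono_null (t := ∅) (fun x hx => ?_) measure_empty
    have : 0 < Real.log x := by simpa using hx
    exact absurd (Real.log_nonpos x.2.1 x.2.2) (not_le.2 this)
  · rw [integral_map hm.aemeasurable (by fun_prop), ← hQ l hl]
    refine integral_congr_ae ?_
    filter_upwards [h5] with x hx
    have hx' : (0 : ℝ) < x := lt_of_le_of_ne x.2.1 fun h => hx (Subtype.ext h.symm)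
    rw [Real.rpow_def_of_pos hx']
    ring_nf

theorem IsSubordinator.lap_eq {c : ℝ} {π : ℝ → Measure ℝ} (h : IsSubordinator c ν π) {r l : ℝ}
    (hr : 0 ≤ r) (hl : 0 < l) : lap (π r) l =
      ENNReal.ofReal (Real.exp (-r * (c * l + ∫ w in Ioi (0 : ℝ), (1 - Real.exp (-l * w)) ∂ν))) := by
  have := h.isProbability r hr
  rw [lap_eq_ofReal_integral (h.nonneg r hr) hl, h.laplace r l hr hl]

/-- The law at time `r` is the infinitely divisible law with drift `r c` and Lévy measure `r ν`. The
semigroup property holds because the transforms multiply and determine the measures. -/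
theorem exists_isSubordinator {c : ℝ} (hc : 0 ≤ c) (h0 : ν (Iic 0) = 0)
    (hν : ∫⁻ w, ENNReal.ofReal (min 1 w) ∂ν < ⊤) : ∃ π, IsSubordinator c ν π := by
  have key : ∀ r : ℝ, ∃ π : Measure ℝ, 0 ≤ r → IsProbabilityMeasure π ∧ π (Iio 0) = 0 ∧ ∀ l, 0 < l →
      ∫ x, Real.exp (-l * x) ∂π =
        Real.exp (-r * (c * l + ∫ w in Ioi (0 : ℝ), (1 - Real.exp (-l * w)) ∂ν)) := by
    intro r
    by_cases hr : 0 ≤ r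
    · have hν' : ∫⁻ w, ENNReal.ofReal (min 1 w) ∂(ENNReal.ofReal r • ν) < ⊤ := by
        rw [lintegral_smul_measure]
        exact ENNReal.mul_lt_top ENNReal.ofReal_lt_top hν
      obtain ⟨π, h1, h2, h3⟩ := exists_law_of_exponent (mul_nonneg hr hc) hν'
      refine ⟨π, fun _ => ⟨h1, h2, fun l hl => ?_⟩⟩
      rw [h3 l hl, Measure.restrict_smul, integral_smul_measure, ENNReal.toReal_ofReal hr, smul_eq_mul]
      ring_nf
    · exact ⟨0, fun h => absurd h hr⟩
  choose π hπ using key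
  refine ⟨π, hc, h0, hν, fun r hr => (hπ r hr).1, fun r hr => (hπ r hr).2.1, fun r s hr hs => ?_,
    fun r l hr hl => (hπ r hr).2.2 l hl⟩
  have := (hπ r hr).1
  have := (hπ s hs).1
  have := (hπ _ (add_nonneg hr hs)).1
  have hlap : ∀ r, 0 ≤ r → ∀ l, 0 < l → lap (π r) l =
      ENNReal.ofReal (Real.exp (-r * (c * l + ∫ w in Ioi (0 : ℝ), (1 - Real.exp (-l * w)) ∂ν))) := by
    intro r hr l hl
    have := (hπ r hr).1
    rw [lap_eq_ofReal_integral (hπ r hr).2.1 hl, (hπ r hr).2.2 l hl]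
  refine ext_of_lap (hπ _ (add_nonneg hr hs)).2.1 (conv_Iio_zero (hπ r hr).2.1 (hπ s hs).2.1)
    (by rw [hlap _ (add_nonneg hr hs) 1 one_pos]; exact ENNReal.ofReal_ne_top) fun l hl => ?_
  rw [lap_conv, hlap _ (add_nonneg hr hs) l hl, hlap r hr l hl, hlap s hs l hl,
    ← ENNReal.ofReal_mul (Real.exp_pos _).le, ← Real.exp_add]
  ring_nf

/-- Measurability in time is not part of `IsSubordinator`; it follows from the explicit transforms.
The `max` avoids negative times, where `π` is arbitrary. -/
theorem IsSubordinator.measurable {c : ℝ} {π : ℝ → Measure ℝ} (h : IsSubordinator c ν π) :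
    Measurable fun r => π (max r 0) := by
  refine measurable_of_measurable_lap (fun r => h.nonneg _ (le_max_right _ _)) (fun r => ?_)
    fun l hl => ?_
  · rw [h.lap_eq (le_max_right _ _) one_pos]
    exact ENNReal.ofReal_ne_top
  · simp_rw [fun r => h.lap_eq (le_max_right r 0) hl]
    fun_prop

theorem IsSubordinator.aemeasurable {c : ℝ} {π : ℝ → Measure ℝ} (h : IsSubordinator c ν π) :
    AEMeasurable π (volume.restrict (Ici 0)) :=
  ⟨_, h.measurable, by
    filter_upwards [ae_restrict_mem measurableSet_Ici] with r hr
    rw [max_eq_left hr]⟩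

theorem IsSubordinator.exists_isRenewalMeasure {c : ℝ} {π : ℝ → Measure ℝ} {H : ℝ → ℝ}
    (h : IsSubordinator c ν π) (hH : ∀ v, 0 < v → ν (Ioi v) = ENNReal.ofReal (H v)) :
    ∃ V, IsRenewalMeasure c H V :=
  ⟨(volume.restrict (Ici 0)).bind π, ν, π, h, hH, fun _ hB =>
    Measure.bind_apply hB h.aemeasurable⟩

theorem IsRenewalMeasure.Iio_zero {c : ℝ} {H : ℝ → ℝ} {V : Measure ℝ}
    (h : IsRenewalMeasure c H V) : V (Iio 0) = 0 := by
  obtain ⟨ν, π, hπ, -, hV⟩ := h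
  rw [hV _ measurableSet_Iio, setLIntegral_congr_fun measurableSet_Ici
    (g := fun _ => 0) fun r hr => hπ.nonneg r hr]
  simp

end Subordinator

/-! ### Renewal measures and the renewal equation on the line -/

section Renewal

theorem lintegral_exp_neg_mul_Ici {l : ℝ} (hl : 0 < l) :
    ∫⁻ x in Ici (0 : ℝ), ENNReal.ofReal (Real.exp (-l * x)) = ENNReal.ofReal (1 / l) := by
  rw [← restrict_Ioi_eq_restrict_Ici, ← ofReal_integral_eq_lintegral_ofReal
    (integrableOn_exp_mul_Ioi (neg_lt_zero.2 hl) 0) (.of_forall fun x => (Real.exp_pos _).le),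
    integral_exp_mul_Ioi (neg_lt_zero.2 hl)]
  simp

/-- Layer-cake formula, with `1 - exp (-l w)` written as the integral of `l exp (-l v)` over `(0,
w)`. -/
theorem lintegral_one_sub_exp (ν : Measure ℝ) {l : ℝ} (hl : 0 < l) :
    ∫⁻ w in Ioi (0 : ℝ), ENNReal.ofReal (1 - Real.exp (-l * w)) ∂ν =
      ∫⁻ v in Ioi (0 : ℝ), ν (Ioi v) * ENNReal.ofReal (l * Real.exp (-l * v)) := by
  have h := lintegral_comp_eq_lintegral_meas_lt_mul (ν.restrict (Ioi 0)) (f := fun w => w)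
    (g := fun v => l * Real.exp (-l * v))
    (by filter_upwards [ae_restrict_mem measurableSet_Ioi] with w hw using le_of_lt hw)
    (by fun_prop) (fun t _ => (by fun_prop : Continuous _).intervalIntegrable _ _)
    (.of_forall fun t => by positivity)
  have h1 : ∀ w : ℝ, ∫ v in (0 : ℝ)..w, l * Real.exp (-l * v) = 1 - Real.exp (-l * w) := by
    intro w
    have hd : ∀ v ∈ uIcc 0 w, HasDerivAt (fun v => -Real.exp (-l * v)) (l * Real.exp (-l * v)) v := by
      intro v _
      have : HasDerivAt (fun v => -Real.exp (-l * v)) (-(Real.exp (-l * v) * (-l * 1))) v :=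
        (((hasDerivAt_id v).const_mul (-l)).exp).neg
      convert this using 1
      ring
    rw [intervalIntegral.integral_eq_sub_of_hasDerivAt hd
      ((by fun_prop : Continuous _).intervalIntegrable _ _)]
    simp
    ring
  simp_rw [h1] at h
  rw [h]
  refine setLIntegral_congr_fun measurableSet_Ioi fun v hv => ?_
  congr 1
  rw [Measure.restrict_apply (by measurability)]
  congr 1
  ext w
  simpa using fun hw : v < w => lt_trans hv hw

variable {c : ℝ} {H : ℝ → ℝ} {V : Measure ℝ} {ν : Measure ℝ}

/-- Real tails of a Lévy measure are measurable and integrable against exponentials. -/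
theorem integrableOn_exp_mul_tail (hν : ∫⁻ w, ENNReal.ofReal (min 1 w) ∂ν < ⊤)
    (hνH : ∀ v, 0 < v → ν (Ioi v) = ENNReal.ofReal (H v)) (hH : ∀ v, 0 < v → 0 ≤ H v)
    {l : ℝ} (hl : 0 < l) :
    IntegrableOn (fun v => Real.exp (-l * v) * H v) (Ioi 0) ∧
      ∫ w in Ioi (0 : ℝ), (1 - Real.exp (-l * w)) ∂ν =
        l * ∫ v in Ioi (0 : ℝ), Real.exp (-l * v) * H v := by
  have hHeq : ∀ v, 0 < v → H v = (ν (Ioi v)).toReal := fun v hv => by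
    rw [hνH v hv, ENNReal.toReal_ofReal (hH v hv)]
  have hm : AEStronglyMeasurable (fun v => Real.exp (-l * v) * H v) (volume.restrict (Ioi 0)) := by
    have hanti : Antitone fun v => ν (Ioi v) := fun v w hvw => measure_mono (Ioi_subset_Ioi hvw)
    refine AEStronglyMeasurable.congr (f := fun v => Real.exp (-l * v) * (ν (Ioi v)).toReal)
      ?_ ?_
    · have := hanti.measurable.ennreal_toReal
      exact Measurable.aestronglyMeasurable (by fun_prop)
    · filter_upwards [ae_restrict_mem measurableSet_Ioi] with v hv
      rw [hHeq v hv]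
  have hnn : 0 ≤ᵐ[volume.restrict (Ioi 0)] fun v => Real.exp (-l * v) * H v := by
    filter_upwards [ae_restrict_mem measurableSet_Ioi] with v hv
    exact mul_nonneg (Real.exp_pos _).le (hH v hv)
  have hI := integrableOn_one_sub_exp hν hl
  have hInn : 0 ≤ᵐ[ν.restrict (Ioi 0)] fun w => 1 - Real.exp (-l * w) := by
    filter_upwards [ae_restrict_mem measurableSet_Ioi] with w hw using one_sub_exp_nonneg hl hw
  have key : ∫⁻ w in Ioi (0 : ℝ), ENNReal.ofReal (1 - Real.exp (-l * w)) ∂ν =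
      ENNReal.ofReal l * ∫⁻ v in Ioi (0 : ℝ), ENNReal.ofReal (Real.exp (-l * v) * H v) := by
    rw [lintegral_one_sub_exp ν hl, ← lintegral_const_mul' _ _ ENNReal.ofReal_ne_top]
    refine setLIntegral_congr_fun measurableSet_Ioi fun v hv => ?_
    rw [hνH v hv, ← ENNReal.ofReal_mul (hH v hv), ← ENNReal.ofReal_mul hl.le]
    ring_nf
  have hlt : ∫⁻ v in Ioi (0 : ℝ), ENNReal.ofReal (Real.exp (-l * v) * H v) ≠ ⊤ := by
    have h1 := hI.lintegral_lt_top
    rw [key] at h1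
    exact (ENNReal.lt_top_of_mul_ne_top_right h1.ne (by simpa using hl)).ne
  refine ⟨⟨hm, (hasFiniteIntegral_iff_ofReal hnn).2 hlt.lt_top⟩, ?_⟩
  rw [integral_eq_lintegral_of_nonneg_ae hInn hI.1, key, ENNReal.toReal_mul,
    ENNReal.toReal_ofReal hl.le, ← integral_eq_lintegral_of_nonneg_ae hnn hm]

/-- Integrating the transforms of the laws over `r` gives that of `V`; beyond this formula and the
support of `V`, the semigroup is not needed again. -/
theorem IsRenewalMeasure.exists_levy (h : IsRenewalMeasure c H V) :
    0 ≤ c ∧ ∃ ν : Measure ℝ, ∫⁻ w, ENNReal.ofReal (min 1 w) ∂ν < ⊤ ∧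
      (∀ v, 0 < v → ν (Ioi v) = ENNReal.ofReal (H v)) ∧
      ∀ l, 0 < l → lap V l = ∫⁻ r in Ici (0 : ℝ), ENNReal.ofReal
        (Real.exp (-r * (c * l + ∫ w in Ioi (0 : ℝ), (1 - Real.exp (-l * w)) ∂ν))) := by
  obtain ⟨ν, π, hπ, hH, hV⟩ := h
  refine ⟨hπ.drift_nonneg, ν, hπ.levy_finite, hH, fun l hl => ?_⟩
  have hVb : V = (volume.restrict (Ici 0)).bind π := by
    ext B hB
    rw [hV B hB, Measure.bind_apply hB hπ.aemeasurable]
  rw [lap, hVb, Measure.lintegral_bind hπ.aemeasurable (by fun_prop)]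
  exact setLIntegral_congr_fun measurableSet_Ici fun r hr => hπ.lap_eq hr hl

theorem IsRenewalMeasure.integrableOn (h : IsRenewalMeasure c H V) (hH : ∀ v, 0 < v → 0 ≤ H v)
    {l : ℝ} (hl : 0 < l) : IntegrableOn (fun v => Real.exp (-l * v) * H v) (Ioi 0) := by
  obtain ⟨-, ν, hν, hνH, -⟩ := h.exists_levy
  exact (integrableOn_exp_mul_tail hν hνH hH hl).1

/-- Tails decrease, so a single positive value `H v₀` makes `H` positive on all of `(0, v₀]`. -/
theorem IsRenewalMeasure.exponent_pos (h : IsRenewalMeasure c H V) (hH : ∀ v, 0 < v → 0 ≤ H v)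
    (hne : 0 < c ∨ ∃ v, 0 < v ∧ 0 < H v) {l : ℝ} (hl : 0 < l) :
    0 < c + ∫ v in Ioi (0 : ℝ), Real.exp (-l * v) * H v := by
  obtain ⟨hc, ν, hν, hνH, -⟩ := h.exists_levy
  have hnn : 0 ≤ᵐ[volume.restrict (Ioi 0)] fun v => Real.exp (-l * v) * H v := by
    filter_upwards [ae_restrict_mem measurableSet_Ioi] with v hv
    exact mul_nonneg (Real.exp_pos _).le (hH v hv)
  rcases hne with hc' | ⟨v₀, hv₀, hHv₀⟩
  · exact add_pos_of_pos_of_nonneg hc' (integral_nonneg_of_ae hnn)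
  · refine add_pos_of_nonneg_of_pos hc ?_
    rw [setIntegral_pos_iff_support_of_nonneg_ae hnn (h.integrableOn hH hl)]
    have hsub : Ioc 0 v₀ ⊆ (Function.support fun v => Real.exp (-l * v) * H v) ∩ Ioi 0 := by
      intro v hv
      refine ⟨?_, hv.1⟩
      have h1 : ν (Ioi v₀) ≤ ν (Ioi v) := measure_mono (Ioi_subset_Ioi hv.2)
      rw [hνH _ hv₀, hνH _ hv.1, ENNReal.ofReal_le_ofReal_iff (hH v hv.1)] at h1
      exact (mul_pos (Real.exp_pos _) (hHv₀.trans_le h1)).ne'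
    refine lt_of_lt_of_le ?_ (measure_mono hsub)
    simpa using hv₀

theorem IsRenewalMeasure.lap_eq (h : IsRenewalMeasure c H V) (hH : ∀ v, 0 < v → 0 ≤ H v)
    (hne : 0 < c ∨ ∃ v, 0 < v ∧ 0 < H v) {l : ℝ} (hl : 0 < l) :
    lap V l = ENNReal.ofReal (1 / l * (1 / (c + ∫ v in Ioi (0 : ℝ), Real.exp (-l * v) * H v))) := by
  have hpos := h.exponent_pos hH hne hl
  obtain ⟨-, ν, hν, hνH, hV⟩ := h.exists_levy
  rw [hV l hl, (integrableOn_exp_mul_tail hν hνH hH hl).2, mul_comm c l, ← mul_add, one_div_mul_one_div,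
    ← lintegral_exp_neg_mul_Ici (mul_pos hl hpos)]
  simp_rw [neg_mul, mul_comm]

theorem IsRenewalMeasure.integral_exp (h : IsRenewalMeasure c H V) (hH : ∀ v, 0 < v → 0 ≤ H v)
    (hne : 0 < c ∨ ∃ v, 0 < v ∧ 0 < H v) {l : ℝ} (hl : 0 < l) :
    IntegrableOn (fun t => Real.exp (-l * t)) (Ici 0) V ∧
      ∫ t in Ici (0 : ℝ), Real.exp (-l * t) ∂V =
        1 / l * (1 / (c + ∫ v in Ioi (0 : ℝ), Real.exp (-l * v) * H v)) := by
  have hpos := h.exponent_pos hH hne hl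
  have hlap := h.lap_eq hH hne hl
  have hV : V.restrict (Ici 0) = V :=
    Measure.restrict_eq_self_of_ae_mem (ae_nonneg_of_measure_Iio h.Iio_zero)
  rw [IntegrableOn, hV]
  have hnn : 0 ≤ᵐ[V] fun t => Real.exp (-l * t) := .of_forall fun t => (Real.exp_pos _).le
  refine ⟨⟨by fun_prop, (hasFiniteIntegral_iff_ofReal hnn).2 ?_⟩, ?_⟩
  · change lap V l < ⊤
    rw [hlap]
    exact ENNReal.ofReal_lt_top
  · rw [integral_eq_lintegral_of_nonneg_ae hnn (by fun_prop)]
    change (lap V l).toReal = _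
    rw [hlap, ENNReal.toReal_ofReal (by positivity)]

theorem IsRenewalMeasure.lap_ne_top (h : IsRenewalMeasure c H V) (hH : ∀ v, 0 < v → 0 ≤ H v)
    (hne : 0 < c ∨ ∃ v, 0 < v ∧ 0 < H v) : lap V 1 ≠ ⊤ := by
  rw [h.lap_eq hH hne one_pos]
  exact ENNReal.ofReal_ne_top

/-- `V` has density `exp x` with respect to the finite measure `exp (-x) V(dx)`. -/
theorem IsRenewalMeasure.sFinite (h : IsRenewalMeasure c H V) (hH : ∀ v, 0 < v → 0 ≤ H v)
    (hne : 0 < c ∨ ∃ v, 0 < v ∧ 0 < H v) : SFinite V := by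
  have : IsFiniteMeasure (V.withDensity fun x => ENNReal.ofReal (Real.exp (-1 * x))) :=
    isFiniteMeasure_withDensity (h.lap_ne_top hH hne)
  have h2 := withDensity_inv_same (μ := V) (f := fun x => ENNReal.ofReal (Real.exp (-1 * x)))
    (by fun_prop) (.of_forall fun x => by simp [Real.exp_pos]) (.of_forall fun x => by simp)
  rw [← h2]
  infer_instance

/-- The renewal equation: a renewal measure is inverse, up to integration in time, to the measure
with atom `c` at zero and density given by the tail. -/
theorem IsRenewalMeasure.conv_eq (h : IsRenewalMeasure c H V) (hH : ∀ v, 0 < v → 0 ≤ H v)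
    (hne : 0 < c ∨ ∃ v, 0 < v ∧ 0 < H v) {T : ℝ → ℝ≥0∞} (hT : Measurable T)
    (hTH : ∀ v, 0 < v → T v = ENNReal.ofReal (H v)) :
    V.conv (ENNReal.ofReal c • Measure.dirac 0 + (volume.restrict (Ioi (0 : ℝ))).withDensity T) =
      volume.restrict (Ici 0) := by
  obtain ⟨hc, -⟩ := h.exists_levy
  set κ : Measure ℝ :=
    ENNReal.ofReal c • Measure.dirac 0 + (volume.restrict (Ioi (0 : ℝ))).withDensity T with hκ
  have hVfin : SFinite V := h.sFinite hH hne
  have hκ0 : κ (Iio 0) = 0 := by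
    rw [hκ, Measure.add_apply, Measure.smul_apply, Measure.dirac_apply' _ measurableSet_Iio,
      withDensity_apply _ measurableSet_Iio, Measure.restrict_restrict measurableSet_Iio]
    have : Iio (0 : ℝ) ∩ Ioi 0 = ∅ := by
      ext x; simpa using fun hx : x < 0 => hx.le
    simp [this]
  have hκlap : ∀ l, 0 < l → lap κ l =
      ENNReal.ofReal (c + ∫ v in Ioi (0 : ℝ), Real.exp (-l * v) * H v) := by
    intro l hl
    have hnn : 0 ≤ᵐ[volume.restrict (Ioi 0)] fun v => Real.exp (-l * v) * H v := by
      filter_upwards [ae_restrict_mem measurableSet_Ioi] with v hv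
      exact mul_nonneg (Real.exp_pos _).le (hH v hv)
    have hf : Measurable fun x => ENNReal.ofReal (Real.exp (-l * x)) := by fun_prop
    rw [lap, hκ, lintegral_add_measure, lintegral_smul_measure, lintegral_dirac' _ hf,
      lintegral_withDensity_eq_lintegral_mul _ hT hf, ENNReal.ofReal_add hc (integral_nonneg_of_ae hnn),
      ofReal_integral_eq_lintegral_ofReal (h.integrableOn hH hl) hnn]
    congr 1
    · simp
    · refine setLIntegral_congr_fun measurableSet_Ioi fun v hv => ?_
      rw [Pi.mul_apply, hTH v hv, mul_comm, ENNReal.ofReal_mul (Real.exp_pos _).le]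
  -- The exponent of `κ` cancels against the denominator in the transform of `V`, leaving `1 / l`.
  have hlap : ∀ l, 0 < l → lap (V.conv κ) l = lap (volume.restrict (Ici 0)) l := by
    intro l hl
    have hpos := h.exponent_pos hH hne hl
    rw [lap_conv, h.lap_eq hH hne hl, hκlap l hl, ← ENNReal.ofReal_mul (by positivity), lap,
      lintegral_exp_neg_mul_Ici hl]
    congr 1
    rw [mul_assoc, one_div_mul_cancel hpos.ne', mul_one]
  refine ext_of_lap (conv_Iio_zero h.Iio_zero hκ0) ?_ ?_ hlap
  · rw [Measure.restrict_apply measurableSet_Iio]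
    have : Iio (0 : ℝ) ∩ Ici 0 = ∅ := by ext x; simp
    simp [this]
  · rw [hlap 1 one_pos, lap, lintegral_exp_neg_mul_Ici one_pos]
    exact ENNReal.ofReal_ne_top

end Renewal

/-! ### Regularity of the tails of the jump kernel -/

section Coefficients

variable {d : ℕ} {γ : Space d × ℝ → ℝ} {K : Space d × ℝ → Measure (Space d × ℝ)}

theorem measurableSet_lt_snd (v : ℝ) : MeasurableSet {q : Space d × ℝ | v < q.2} :=
  measurableSet_lt measurable_const measurable_snd

theorem IsCoefficients.tail_lt_top (hK : IsCoefficients γ K) (p : Space d × ℝ) {v : ℝ}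
    (hv : 0 < v) : tail K p v < ⊤ := by
  have h := mul_meas_ge_le_lintegral (μ := K p)
    (f := fun q : Space d × ℝ => ENNReal.ofReal (min 1 (‖q.1‖ ^ 2 + q.2 ^ 2)))
    (by fun_prop) (ENNReal.ofReal (min 1 (v ^ 2)))
  have h1 : tail K p v ≤ K p {q | ENNReal.ofReal (min 1 (v ^ 2)) ≤
      ENNReal.ofReal (min 1 (‖q.1‖ ^ 2 + q.2 ^ 2))} := by
    refine measure_mono fun q hq => ENNReal.ofReal_le_ofReal (min_le_min_left _ ?_)
    have hq' : v < q.2 := hq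
    nlinarith [sq_nonneg ‖q.1‖]
  refine lt_of_le_of_lt h1 (ENNReal.lt_top_of_mul_ne_top_right
    (lt_of_le_of_lt h (hK.jump_levy p)).ne ?_)
  simp [hv.ne']

theorem tail_antitone (p : Space d × ℝ) : Antitone (tail K p) := fun _ _ h =>
  measure_mono fun _ hq => lt_of_le_of_lt h hq

/-- For `v > 0` the indicator of `{w > v}` vanishes near the origin, so `jump_continuous` applies to
it. -/
theorem IsCoefficients.tail_continuous_bounded (hK : IsCoefficients γ K) {v : ℝ} (hv : 0 < v) :
    Continuous (fun p => (tail K p v).toReal) ∧ ∃ C, ∀ p, (tail K p v).toReal ≤ C := by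
  have h := hK.jump_continuous ({q | v < q.2}.indicator fun _ => 1)
    (measurable_const.indicator (measurableSet_lt_snd v))
    ⟨1, fun q => by by_cases hq : v < q.2 <;> simp [hq]⟩ ?_
  · have h1 : ∀ p, ∫ q, ({q : Space d × ℝ | v < q.2}.indicator (fun _ => (1 : ℝ))) q ∂(K p) =
        (tail K p v).toReal := by
      intro p
      rw [integral_indicator_const _ (measurableSet_lt_snd v), smul_eq_mul, mul_one]
      rfl
    simp_rw [h1] at h
    exact ⟨h.1, h.2.imp fun C hC p => (le_abs_self _).trans (hC p)⟩
  · have : ∀ᶠ q : Space d × ℝ in 𝓝 0, q.2 < v :=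
      (continuous_snd.tendsto (0 : Space d × ℝ)).eventually_lt_const hv
    filter_upwards [this] with q hq
    simp [hq.le]

/-- The tail, set to zero off `(0, ∞)`. -/
noncomputable def posTail (K : Space d × ℝ → Measure (Space d × ℝ)) (p : Space d × ℝ) : ℝ → ℝ≥0∞ :=
  (Ioi 0).indicator (tail K p)

theorem posTail_of_pos {p : Space d × ℝ} {v : ℝ} (hv : 0 < v) : posTail K p v = tail K p v :=
  indicator_of_mem (mem_Ioi.2 hv) _

theorem withDensity_tail_eq (p : Space d × ℝ) :
    (volume.restrict (Ioi (0 : ℝ))).withDensity (tail K p) =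
      (volume.restrict (Ioi (0 : ℝ))).withDensity (posTail K p) := by
  refine withDensity_congr_ae ?_
  filter_upwards [ae_restrict_mem measurableSet_Ioi] with v hv
  rw [posTail_of_pos hv]

/-- Joint measurability comes from right continuity in `v`: the tail at `v` is the supremum of the
tails at rationals `r > v`, each continuous in the space-time point. -/
theorem IsCoefficients.measurable_posTail (hK : IsCoefficients γ K) :
    Measurable fun x : (Space d × ℝ) × ℝ => posTail K x.1 x.2 := by
  have h : ∀ x : (Space d × ℝ) × ℝ, posTail K x.1 x.2 =
      ⨆ r : ℚ, {x : (Space d × ℝ) × ℝ | 0 < x.2 ∧ x.2 < r}.indicator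
        (fun x => tail K x.1 (r : ℝ)) x := by
    intro x
    refine le_antisymm ?_ (iSup_le fun r => ?_)
    · by_cases hx : 0 < x.2
      · rw [posTail_of_pos hx]
        have hU : {q : Space d × ℝ | x.2 < q.2} =
            ⋃ r : {r : ℚ // x.2 < r}, {q : Space d × ℝ | ((r : ℚ) : ℝ) < q.2} := by
          ext q
          simp only [mem_iUnion, mem_ofPred_eq]
          refine ⟨fun hq => ?_, fun ⟨r, hr⟩ => r.2.trans hr⟩
          obtain ⟨r, hr1, hr2⟩ := exists_rat_btwn hq
          exact ⟨⟨r, hr1⟩, hr2⟩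
        rw [tail, hU, Directed.measure_iUnion]
        · refine iSup_le fun r => ?_
          refine le_trans ?_ (le_iSup _ (r : ℚ))
          rw [indicator_of_mem (show x ∈ {x : (Space d × ℝ) × ℝ | 0 < x.2 ∧ x.2 < (r : ℚ)} from
            ⟨hx, r.2⟩)]
          rfl
        · intro r s
          rcases le_total (r : ℚ) (s : ℚ) with h | h
          · exact ⟨r, subset_rfl, fun q (hq : ((s : ℚ) : ℝ) < q.2) => lt_of_le_of_lt (Rat.cast_le.2 h) hq⟩
          · exact ⟨s, fun q (hq : ((r : ℚ) : ℝ) < q.2) => lt_of_le_of_lt (Rat.cast_le.2 h) hq, subset_rfl⟩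
      · simp [posTail, hx]
    · by_cases hx : 0 < x.2 ∧ x.2 < r
      · rw [indicator_of_mem (show x ∈ {x : (Space d × ℝ) × ℝ | 0 < x.2 ∧ x.2 < r} from hx),
          posTail_of_pos hx.1]
        exact tail_antitone _ hx.2.le
      · rw [indicator_of_notMem (show x ∉ {x : (Space d × ℝ) × ℝ | 0 < x.2 ∧ x.2 < r} from hx)]
        exact zero_le
  simp_rw [h]
  refine Measurable.iSup fun r => ?_
  have hms : MeasurableSet {x : (Space d × ℝ) × ℝ | 0 < x.2 ∧ x.2 < (r : ℝ)} :=
    (measurableSet_lt measurable_const measurable_snd).inter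
      (measurableSet_lt measurable_snd measurable_const)
  by_cases hr : 0 < (r : ℝ)
  · refine Measurable.indicator ?_ hms
    have h1 : ∀ p, tail K p (r : ℝ) = ENNReal.ofReal (tail K p (r : ℝ)).toReal := fun p =>
      (ENNReal.ofReal_toReal (hK.tail_lt_top p hr).ne).symm
    have h2 : (fun x : (Space d × ℝ) × ℝ => tail K x.1 (r : ℝ)) =
        fun x => ENNReal.ofReal (tail K x.1 (r : ℝ)).toReal := funext fun x => h1 x.1
    rw [h2]
    exact ((hK.tail_continuous_bounded hr).1.measurable.comp measurable_fst).ennreal_ofReal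
  · have : {x : (Space d × ℝ) × ℝ | 0 < x.2 ∧ x.2 < (r : ℝ)} = ∅ := by
      ext x
      simp only [mem_ofPred_eq, mem_empty_iff_false, iff_false]
      exact fun hx => hr (hx.1.trans hx.2)
    simp [this]

/-- An integrable function dominating all tails on a bounded interval. -/
theorem IsCoefficients.exists_dominating (hK : IsCoefficients γ K) (T : ℝ) :
    ∃ m : ℝ → ℝ, Integrable m ∧ (∀ v, 0 ≤ m v) ∧
      ∀ p v, 0 < v → v ≤ T → (tail K p v).toReal ≤ m v := by
  set M : ℝ → ℝ≥0∞ := fun v => ⨆ p, tail K p v with hM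
  have hanti : Antitone M := fun v w h => iSup_mono fun p => tail_antitone p h
  have hfin : ∀ v, 0 < v → M v < ⊤ := by
    intro v hv
    obtain ⟨C, hC⟩ := (hK.tail_continuous_bounded hv).2
    refine lt_of_le_of_lt (iSup_le fun p => ?_) (ENNReal.ofReal_lt_top (r := C))
    rw [← ENNReal.ofReal_toReal (hK.tail_lt_top p hv).ne]
    exact ENNReal.ofReal_le_ofReal (hC p)
  have hint : ∫⁻ v in Ioc 0 T, M v < ⊤ := by
    -- Up to `1` this is `tail_uniform`; beyond `1`, monotonicity bounds `M` by the finite value `M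
    -- 1`.
    have hsub : Ioc 0 T ⊆ Ioc 0 1 ∪ Ioc 1 T := fun v hv => by
      rcases le_or_gt v 1 with h | h
      · exact .inl ⟨hv.1, h⟩
      · exact .inr ⟨h, hv.2⟩
    refine lt_of_le_of_lt (lintegral_mono_set hsub) (lt_of_le_of_lt (lintegral_union_le _ _ _) ?_)
    refine ENNReal.add_lt_top.2 ⟨hK.tail_uniform, ?_⟩
    refine lt_of_le_of_lt (setLIntegral_mono measurable_const fun v hv => hanti hv.1.le) ?_
    rw [setLIntegral_const]
    exact ENNReal.mul_lt_top (hfin 1 one_pos) (by simp)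
  refine ⟨(Ioc 0 T).indicator fun v => (M v).toReal, ?_, fun v => indicator_nonneg (fun _ _ =>
    ENNReal.toReal_nonneg) _, fun p v hv hvT => ?_⟩
  · rw [integrable_indicator_iff measurableSet_Ioc]
    exact integrable_toReal_of_lintegral_ne_top hanti.measurable.aemeasurable hint.ne
  · rw [indicator_of_mem (show v ∈ Ioc 0 T from ⟨hv, hvT⟩)]
    exact ENNReal.toReal_mono (hfin v hv).ne (le_iSup (fun p => tail K p v) p)

/-- The Lévy measure is the time marginal of `K p` on `(0, ∞)`: small jumps are controlled by finite
variation, large ones by the tail at `1`. -/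
theorem IsCoefficients.exists_isRenewalMeasure (hK : IsCoefficients γ K) (p : Space d × ℝ)
    {H : ℝ → ℝ} (hH : ∀ v, 0 < v → (tail K p v).toReal = H v) :
    ∃ V, IsRenewalMeasure (γ p) H V := by
  set ν : Measure ℝ := ((K p).map Prod.snd).restrict (Ioi 0) with hν
  have h0 : ν (Iic 0) = 0 := by
    rw [hν, Measure.restrict_apply measurableSet_Iic, Iic_inter_Ioi, Ioc_self, measure_empty]
  have hfin : ∫⁻ w, ENNReal.ofReal (min 1 w) ∂ν < ⊤ := by
    rw [hν, setLIntegral_map measurableSet_Ioi (by fun_prop) measurable_snd]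
    have hsub : Prod.snd ⁻¹' Ioi (0 : ℝ) ⊆ {q : Space d × ℝ | q.2 ≤ 1} ∪ {q | 1 < q.2} :=
      fun q _ => le_or_gt q.2 1
    refine lt_of_le_of_lt (lintegral_mono_set hsub) (lt_of_le_of_lt (lintegral_union_le _ _ _) ?_)
    refine ENNReal.add_lt_top.2 ⟨lt_of_le_of_lt (lintegral_mono fun q =>
      ENNReal.ofReal_le_ofReal (min_le_right _ _)) (hK.jump_finite_variation p), ?_⟩
    refine lt_of_le_of_lt (lintegral_mono fun q =>
      ENNReal.ofReal_le_ofReal (min_le_left _ _)) ?_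
    rw [setLIntegral_const]
    exact ENNReal.mul_lt_top (by simp) (hK.tail_lt_top p one_pos)
  obtain ⟨π, hπ⟩ := exists_isSubordinator (hK.drift_nonneg p) h0 hfin
  refine hπ.exists_isRenewalMeasure fun v hv => ?_
  rw [hν, Measure.restrict_apply measurableSet_Ioi, Ioi_inter_Ioi, max_eq_left hv.le,
    Measure.map_apply measurable_snd measurableSet_Ioi, ← hH v hv,
    ENNReal.ofReal_toReal (hK.tail_lt_top p hv).ne]
  rfl

end Coefficients

/-! ### Convolution in time as an operation on measures on the slab -/

section TimeConv

/-- A family of measures against which integration preserves joint measurability. -/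
def IsMeasurableFamily {α : Type*} [MeasurableSpace α] (κ : α → Measure ℝ) : Prop :=
  ∀ f : α × ℝ → ℝ≥0∞, Measurable f → Measurable fun p => ∫⁻ u, f (p, u) ∂(κ p)

/-- The masses need not be uniformly bounded; dividing by `1 +` the mass yields a finite kernel. -/
theorem isMeasurableFamily_of_isFiniteMeasure {α : Type*} [MeasurableSpace α] {κ : α → Measure ℝ}
    (hκ : Measurable κ) [∀ p, IsFiniteMeasure (κ p)] : IsMeasurableFamily κ := by
  intro f hf
  have hu : Measurable fun p => κ p univ := (Measure.measurable_coe MeasurableSet.univ).comp hκ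
  let η : ProbabilityTheory.Kernel α ℝ := ⟨fun p => (1 + κ p univ)⁻¹ • κ p, by
    refine Measure.measurable_of_measurable_coe _ fun s hs => ?_
    simp only [Measure.smul_apply, smul_eq_mul]
    exact (measurable_const.add hu).inv.mul ((Measure.measurable_coe hs).comp hκ)⟩
  have hη : ProbabilityTheory.IsFiniteKernel η := ⟨⟨1, ENNReal.one_lt_top, fun p => by
    change ((1 + κ p univ)⁻¹ • κ p) univ ≤ 1
    rw [Measure.smul_apply, smul_eq_mul, mul_comm, ← div_eq_mul_inv]
    exact ENNReal.div_le_of_le_mul (by simp)⟩⟩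
  have h : ∀ p, ∫⁻ u, f (p, u) ∂(κ p) = (1 + κ p univ) * ∫⁻ u, f (p, u) ∂(η p) := by
    intro p
    change _ = _ * ∫⁻ u, f (p, u) ∂((1 + κ p univ)⁻¹ • κ p)
    rw [lintegral_smul_measure, smul_eq_mul, ← mul_assoc, ENNReal.mul_inv_cancel (by simp) (by simp),
      one_mul]
  simp_rw [h]
  exact (measurable_const.add hu).mul (hf.lintegral_kernel_prod_right')

/-- Reduces infinite measures such as `V y` to finite ones by the weight `exp (-x)`, which is then
absorbed in the integrand. -/
theorem isMeasurableFamily_of_lap {α : Type*} [MeasurableSpace α] {V : α → Measure ℝ}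
    (hV : Measurable V) (h1 : ∀ y, lap (V y) 1 ≠ ⊤) : IsMeasurableFamily V := by
  have he : Measurable fun x : ℝ => ENNReal.ofReal (Real.exp (-1 * x)) := by fun_prop
  set τ : α → Measure ℝ := fun y => (V y).withDensity fun x => ENNReal.ofReal (Real.exp (-1 * x))
  have hτfin : ∀ y, IsFiniteMeasure (τ y) := fun y => isFiniteMeasure_withDensity (h1 y)
  have hτ : Measurable τ := by
    refine Measure.measurable_of_measurable_coe _ fun s hs => ?_
    simp only [τ, withDensity_apply _ hs, ← lintegral_indicator hs]
    exact (Measure.measurable_lintegral (he.indicator hs)).comp hV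
  intro f hf
  have h : ∀ p, ∫⁻ u, f (p, u) ∂(V p) =
      ∫⁻ u, f (p, u) * ENNReal.ofReal (Real.exp u) ∂(τ p) := by
    intro p
    have hfp : Measurable fun u => f (p, u) := hf.comp measurable_prodMk_left
    rw [lintegral_withDensity_eq_lintegral_mul _ he (by fun_prop)]
    refine lintegral_congr fun u => ?_
    rw [Pi.mul_apply, mul_left_comm, ← ENNReal.ofReal_mul (Real.exp_pos _).le, ← Real.exp_add]
    simp
  simp_rw [h]
  exact isMeasurableFamily_of_isFiniteMeasure hτ (fun x => f x * ENNReal.ofReal (Real.exp x.2))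
    (by fun_prop)

variable {d : ℕ} {a b : ℝ}

theorem measurableEmbedding_incl : MeasurableEmbedding (Slab.incl : Slab d a b → Space d × ℝ) :=
  MeasurableEmbedding.id.prodMap (MeasurableEmbedding.subtype_coe measurableSet_Ico)

@[fun_prop]
theorem measurable_incl : Measurable (Slab.incl : Slab d a b → Space d × ℝ) :=
  measurableEmbedding_incl.measurable

@[fun_prop]
theorem continuous_incl : Continuous (Slab.incl : Slab d a b → Space d × ℝ) := by
  unfold Slab.incl
  fun_prop

theorem range_incl : range (Slab.incl : Slab d a b → Space d × ℝ) = {q | q.2 ∈ Ico a b} := by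
  ext q
  refine ⟨?_, fun h => ⟨(q.1, ⟨q.2, h⟩), rfl⟩⟩
  rintro ⟨p, rfl⟩
  exact p.2.2

/-- Extension by zero of a function on the slab with values in `[0, ∞]`. -/
noncomputable def extZero (f : Slab d a b → ℝ≥0∞) : Space d × ℝ → ℝ≥0∞ :=
  Function.extend Slab.incl f fun _ => 0

theorem measurable_extZero {f : Slab d a b → ℝ≥0∞} (hf : Measurable f) : Measurable (extZero f) :=
  measurableEmbedding_incl.measurable_extend hf measurable_const

theorem extZero_incl (f : Slab d a b → ℝ≥0∞) (p : Slab d a b) : extZero f p.incl = f p :=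
  measurableEmbedding_incl.injective.extend_apply f _ p

theorem extZero_of_notMem (f : Slab d a b → ℝ≥0∞) {q : Space d × ℝ} (hq : q.2 ∉ Ico a b) :
    extZero f q = 0 :=
  Function.extend_apply' f _ q fun ⟨p, hp⟩ => hq (hp ▸ p.2.2)

/-- Restricting the convolution to the slab amounts to extending the test function by zero. -/
theorem lintegral_timeConv {κ : Slab d a b → Measure ℝ} (hκ : IsMeasurableFamily κ)
    (ν : Measure (Slab d a b)) {f : Slab d a b → ℝ≥0∞} (hf : Measurable f) :
    ∫⁻ p, f p ∂(timeConv κ ν) =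
      ∫⁻ p, ∫⁻ u, extZero f (p.1, (p.2 : ℝ) + u) ∂(κ p) ∂ν := by
  have hsh : ∀ p : Slab d a b, Measurable fun u : ℝ => (p.1, (p.2 : ℝ) + u) := fun p => by fun_prop
  have hm : Measurable fun p : Slab d a b => (κ p).map fun u => (p.1, (p.2 : ℝ) + u) := by
    refine Measure.measurable_of_measurable_coe _ fun s hs => ?_
    have : ∀ p : Slab d a b, ((κ p).map fun u => (p.1, (p.2 : ℝ) + u)) s =
        ∫⁻ u, s.indicator 1 (p.1, (p.2 : ℝ) + u) ∂(κ p) := fun p => by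
      rw [← lintegral_map (measurable_one.indicator hs) (hsh p), lintegral_indicator_one hs]
    simp_rw [this]
    exact hκ (fun x : Slab d a b × ℝ => s.indicator 1 (x.1.1, (x.1.2 : ℝ) + x.2))
      ((measurable_one.indicator hs).comp (by fun_prop))
  set μ := ν.bind fun p => (κ p).map fun u => (p.1, (p.2 : ℝ) + u) with hμ
  have h1 : ∫⁻ p, f p ∂(timeConv κ ν) = ∫⁻ q, extZero f q ∂μ := by
    have h2 : ∫⁻ p, f p ∂(timeConv κ ν) = ∫⁻ p : Slab d a b, extZero f p.incl ∂(μ.comap Slab.incl) := by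
      simp_rw [extZero_incl]
      rfl
    rw [h2, ← measurableEmbedding_incl.lintegral_map, measurableEmbedding_incl.map_comap]
    refine setLIntegral_eq_of_support_subset ?_
    intro q hq
    rw [range_incl]
    by_contra h
    exact hq (extZero_of_notMem f h)
  rw [h1, hμ, Measure.lintegral_bind hm.aemeasurable (measurable_extZero hf).aemeasurable]
  exact lintegral_congr fun p => lintegral_map (measurable_extZero hf) (hsh p)

end TimeConv

/-! ### Integrals against differences of finite measures -/

section SignedIntegral

variable {α : Type*} [MeasurableSpace α]

theorem toSigned_eq (μ : Measure α) [IsFiniteMeasure μ] : toSigned μ = μ.toSignedMeasure := by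
  unfold toSigned
  rw [dif_pos]

theorem integral_toSigned_sub (μ ν : Measure α) [IsFiniteMeasure μ] [IsFiniteMeasure ν]
    {f : α → ℝ} (hμ : Integrable f μ) (hν : Integrable f ν) :
    ∫ᵛ x, f x ∂<•(toSigned μ - toSigned ν) = ∫ x, f x ∂μ - ∫ x, f x ∂ν := by
  rw [toSigned_eq, toSigned_eq, VectorMeasure.integral_sub_vectorMeasure
    (by rwa [VectorMeasure.Integrable, Measure.variation_toSignedMeasure])
    (by rwa [VectorMeasure.Integrable, Measure.variation_toSignedMeasure]),
    VectorMeasure.integral_toSignedMeasure, VectorMeasure.integral_toSignedMeasure]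

theorem toSigned_jordan (h : SignedMeasure α) :
    toSigned h.toJordanDecomposition.posPart - toSigned h.toJordanDecomposition.negPart = h := by
  rw [toSigned_eq, toSigned_eq]
  exact h.toSignedMeasure_toJordanDecomposition

theorem integral_signed_eq (h : SignedMeasure α) {f : α → ℝ}
    (hp : Integrable f h.toJordanDecomposition.posPart)
    (hn : Integrable f h.toJordanDecomposition.negPart) :
    ∫ᵛ x, f x ∂<•h = ∫ x, f x ∂h.toJordanDecomposition.posPart -
      ∫ x, f x ∂h.toJordanDecomposition.negPart := by
  conv_lhs => rw [← toSigned_jordan h]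
  exact integral_toSigned_sub _ _ hp hn

end SignedIntegral

/-! ### Extension by zero -/

section ZeroExt

variable {d : ℕ} {a b : ℝ}

theorem zeroExt_eq_extend (f : Slab d a b → ℝ) :
    zeroExt f = Function.extend Slab.incl f fun _ => 0 := by
  funext q
  unfold zeroExt
  split_ifs with h
  · exact (measurableEmbedding_incl.injective.extend_apply f _
      (show Slab d a b from (q.1, ⟨q.2, h⟩))).symm
  · rw [Function.extend_apply']
    rintro ⟨p, rfl⟩
    exact h p.2.2

theorem measurable_zeroExt {f : Slab d a b → ℝ} (hf : Measurable f) : Measurable (zeroExt f) := by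
  rw [zeroExt_eq_extend]
  exact measurableEmbedding_incl.measurable_extend hf measurable_const

theorem zeroExt_of_mem (f : Slab d a b → ℝ) {q : Space d × ℝ} (h : q.2 ∈ Ico a b) :
    zeroExt f q = f (q.1, ⟨q.2, h⟩) := dif_pos h

theorem zeroExt_of_notMem (f : Slab d a b → ℝ) {q : Space d × ℝ} (h : q.2 ∉ Ico a b) :
    zeroExt f q = 0 := dif_neg h

theorem abs_zeroExt_le {f : Slab d a b → ℝ} {C : ℝ} (hC : 0 ≤ C) (hf : ∀ p, |f p| ≤ C)
    (q : Space d × ℝ) : |zeroExt f q| ≤ C := by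
  by_cases h : q.2 ∈ Ico a b
  · rw [zeroExt_of_mem f h]; exact hf _
  · rw [zeroExt_of_notMem f h]; simpa

theorem ofReal_zeroExt (f : Slab d a b → ℝ) (q : Space d × ℝ) :
    ENNReal.ofReal (zeroExt f q) = extZero (fun p => ENNReal.ofReal (f p)) q := by
  by_cases h : q.2 ∈ Ico a b
  · rw [zeroExt_of_mem f h]
    exact (extZero_incl (fun p => ENNReal.ofReal (f p)) (q.1, ⟨q.2, h⟩)).symm
  · rw [zeroExt_of_notMem f h, extZero_of_notMem _ h, ENNReal.ofReal_zero]

theorem zeroExt_sub (f g : Slab d a b → ℝ) (q : Space d × ℝ) :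
    zeroExt (fun p => f p - g p) q = zeroExt f q - zeroExt g q := by
  by_cases h : q.2 ∈ Ico a b
  · simp [zeroExt_of_mem _ h]
  · simp [zeroExt_of_notMem _ h]

end ZeroExt

/-! ### Duality between `Ψ` and `Ψ*` -/

section PsiStar

variable {d : ℕ} {a b : ℝ} {γ : Space d × ℝ → ℝ} {K : Space d × ℝ → Measure (Space d × ℝ)}

theorem IsCoefficients.isMeasurableFamily_tail (hK : IsCoefficients γ K) :
    IsMeasurableFamily fun p : Slab d a b =>
      (volume.restrict (Ioi (0 : ℝ))).withDensity (tail K p.incl) := by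
  intro f hf
  have hT : Measurable fun x : Slab d a b × ℝ => posTail K x.1.incl x.2 :=
    hK.measurable_posTail.comp (g := fun x : (Space d × ℝ) × ℝ => posTail K x.1 x.2)
      (f := fun x : Slab d a b × ℝ => (x.1.incl, x.2)) (by fun_prop)
  have h : ∀ p : Slab d a b,
      ∫⁻ u, f (p, u) ∂((volume.restrict (Ioi (0 : ℝ))).withDensity (tail K p.incl)) =
        ∫⁻ u in Ioi (0 : ℝ), posTail K p.incl u * f (p, u) := by
    intro p
    have hTp : Measurable (posTail K p.incl) := hT.comp (measurable_prodMk_left (x := p))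
    have hfp : Measurable fun u => f (p, u) := hf.comp measurable_prodMk_left
    rw [withDensity_tail_eq, lintegral_withDensity_eq_lintegral_mul _ hTp hfp]
    rfl
  simp_rw [h]
  exact (hT.mul hf).lintegral_prod_right'

/-- `Ψ` on functions with values in `[0, ∞]`. -/
noncomputable def psiENN (γ : Space d × ℝ → ℝ) (K : Space d × ℝ → Measure (Space d × ℝ))
    (f : Slab d a b → ℝ≥0∞) (p : Slab d a b) : ℝ≥0∞ :=
  ENNReal.ofReal (γ p.incl) * f p +
    ∫⁻ u, extZero f (p.1, (p.2 : ℝ) + u) ∂((volume.restrict (Ioi (0 : ℝ))).withDensity (tail K p.incl))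

theorem lintegral_withDensity_tail (hK : IsCoefficients γ K) (p : Space d × ℝ) {f : ℝ → ℝ≥0∞}
    (hf : Measurable f) :
    ∫⁻ u, f u ∂((volume.restrict (Ioi (0 : ℝ))).withDensity (tail K p)) =
      ∫⁻ u in Ioi (0 : ℝ), tail K p u * f u := by
  have hTp : Measurable (posTail K p) := hK.measurable_posTail.comp (measurable_prodMk_left (x := p))
  rw [withDensity_tail_eq, lintegral_withDensity_eq_lintegral_mul _ hTp hf]
  refine setLIntegral_congr_fun measurableSet_Ioi fun u hu => ?_
  rw [Pi.mul_apply]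
  congr 1
  exact posTail_of_pos hu

theorem IsCoefficients.measurable_psiENN (hK : IsCoefficients γ K) {f : Slab d a b → ℝ≥0∞}
    (hf : Measurable f) : Measurable (psiENN γ K f) := by
  have hγ : Measurable fun p : Slab d a b => γ p.incl :=
    (hK.drift_continuous.comp continuous_incl).measurable
  refine (hγ.ennreal_ofReal.mul hf).add ?_
  exact hK.isMeasurableFamily_tail (fun x : Slab d a b × ℝ => extZero f (x.1.1, (x.1.2 : ℝ) + x.2))
    ((measurable_extZero hf).comp (by fun_prop))

theorem IsCoefficients.lintegral_psiStarPos (hK : IsCoefficients γ K) (ν : Measure (Slab d a b))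
    {f : Slab d a b → ℝ≥0∞} (hf : Measurable f) :
    ∫⁻ p, f p ∂(psiStarPos γ K ν) = ∫⁻ p, psiENN γ K f p ∂ν := by
  have hγ : Measurable fun p : Slab d a b => γ p.incl :=
    (hK.drift_continuous.comp continuous_incl).measurable
  unfold psiStarPos
  rw [lintegral_add_measure, lintegral_timeConv hK.isMeasurableFamily_tail ν hf,
    lintegral_withDensity_eq_lintegral_mul _ hγ.ennreal_ofReal hf,
    ← lintegral_add_left (hγ.ennreal_ofReal.mul hf)]
  rfl

/-- `m` is integrable and dominates all tails on `(0, T]`. -/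
structure IsTailBound (K : Space d × ℝ → Measure (Space d × ℝ)) (T : ℝ) (m : ℝ → ℝ) : Prop where
  integrable : Integrable m
  nonneg : ∀ v, 0 ≤ m v
  le : ∀ p v, 0 < v → v ≤ T → (tail K p v).toReal ≤ m v

variable {m : ℝ → ℝ}

theorem IsTailBound.norm_le (hm : IsTailBound K (b - a) m) {f : Slab d a b → ℝ} {p : Slab d a b}
    {C v : ℝ} (hv : 0 < v) (h : |zeroExt f (p.1, (p.2 : ℝ) + v)| ≤ C) :
    ‖zeroExt f (p.1, (p.2 : ℝ) + v) * (tail K p.incl v).toReal‖ ≤ C * m v := by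
  rw [norm_mul, Real.norm_eq_abs, Real.norm_of_nonneg ENNReal.toReal_nonneg]
  by_cases hvT : v ≤ b - a
  · exact mul_le_mul h (hm.le _ _ hv hvT) ENNReal.toReal_nonneg ((abs_nonneg _).trans h)
  -- A shift by more than `b - a` starting at a time `≥ a` ends beyond `b`, so tails are only needed
  -- up to `b - a`.
  · have hp := p.2.2.1
    rw [zeroExt_of_notMem f (fun hq => by have := hq.2; simp only at this; linarith)]
    simpa using mul_nonneg ((abs_nonneg _).trans h) (hm.nonneg v)

theorem aestronglyMeasurable_psi_integrand {f : Slab d a b → ℝ}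
    (hf : Measurable f) (p : Slab d a b) :
    AEStronglyMeasurable (fun v => zeroExt f (p.1, (p.2 : ℝ) + v) * (tail K p.incl v).toReal)
      (volume.restrict (Ioi 0)) := by
  have h1 : Measurable fun v : ℝ => zeroExt f (p.1, (p.2 : ℝ) + v) :=
    (measurable_zeroExt hf).comp (by fun_prop)
  exact (h1.mul (tail_antitone p.incl).measurable.ennreal_toReal).aestronglyMeasurable

theorem IsTailBound.integrableOn (hm : IsTailBound K (b - a) m)
    {f : Slab d a b → ℝ} (hf : Measurable f) {C : ℝ} (p : Slab d a b)
    (h : ∀ v, 0 < v → |zeroExt f (p.1, (p.2 : ℝ) + v)| ≤ C) :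
    IntegrableOn (fun v => zeroExt f (p.1, (p.2 : ℝ) + v) * (tail K p.incl v).toReal) (Ioi 0) := by
  refine Integrable.mono' (hm.integrable.integrableOn.const_mul C)
    (aestronglyMeasurable_psi_integrand hf p) ?_
  filter_upwards [ae_restrict_mem measurableSet_Ioi] with v hv
  exact hm.norm_le hv (h v hv)

/-- `Ψ f` at `p` sees `f` only at `p` and at later times over the same `y`. Asking for the bound
only there lets one estimate serve for the operator norm and for decay at infinity. -/
theorem IsTailBound.abs_psi_le (hm : IsTailBound K (b - a) m) (hK : IsCoefficients γ K) {G : ℝ}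
    (hG : ∀ p, γ p ≤ G) {f : Slab d a b → ℝ} {C : ℝ} {p : Slab d a b} (h0 : |f p| ≤ C)
    (h : ∀ v, 0 < v → |zeroExt f (p.1, (p.2 : ℝ) + v)| ≤ C) :
    |psi γ K f p| ≤ (G + ∫ v in Ioi (0 : ℝ), m v) * C := by
  have hC := (abs_nonneg _).trans h0
  have h1 : |f p * γ p.incl| ≤ C * G := by
    rw [abs_mul, abs_of_nonneg (hK.drift_nonneg _)]
    exact mul_le_mul h0 (hG _) (hK.drift_nonneg _) hC
  have h2 : |∫ v in Ioi (0 : ℝ), zeroExt f (p.1, (p.2 : ℝ) + v) * (tail K p.incl v).toReal| ≤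
      ∫ v in Ioi (0 : ℝ), C * m v := by
    rw [← Real.norm_eq_abs]
    refine norm_integral_le_of_norm_le (hm.integrable.integrableOn.const_mul C) ?_
    filter_upwards [ae_restrict_mem measurableSet_Ioi] with v hv
    exact hm.norm_le hv (h v hv)
  rw [integral_const_mul] at h2
  refine (abs_add_le _ _).trans ((add_le_add h1 h2).trans_eq ?_)
  ring

theorem IsTailBound.ofReal_psi (hm : IsTailBound K (b - a) m) (hK : IsCoefficients γ K)
    {f : Slab d a b → ℝ} (hf : Measurable f) (hf0 : ∀ p, 0 ≤ f p) {C : ℝ} (hfC : ∀ p, |f p| ≤ C)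
    (p : Slab d a b) :
    0 ≤ psi γ K f p ∧
      ENNReal.ofReal (psi γ K f p) = psiENN γ K (fun p => ENNReal.ofReal (f p)) p := by
  have hC : 0 ≤ C := (abs_nonneg _).trans (hfC p)
  have hz : ∀ q, 0 ≤ zeroExt f q := fun q => by
    by_cases h : q.2 ∈ Ico a b
    · rw [zeroExt_of_mem f h]; exact hf0 _
    · rw [zeroExt_of_notMem f h]
  have h1 : 0 ≤ f p * γ p.incl := mul_nonneg (hf0 p) (hK.drift_nonneg _)
  have hnn : ∀ v, 0 ≤ zeroExt f (p.1, (p.2 : ℝ) + v) * (tail K p.incl v).toReal := fun v =>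
    mul_nonneg (hz _) ENNReal.toReal_nonneg
  have h2 : 0 ≤ ∫ v in Ioi (0 : ℝ), zeroExt f (p.1, (p.2 : ℝ) + v) * (tail K p.incl v).toReal :=
    integral_nonneg hnn
  refine ⟨add_nonneg h1 h2, ?_⟩
  have hm' : Measurable fun u : ℝ =>
      extZero (fun p : Slab d a b => ENNReal.ofReal (f p)) (p.1, (p.2 : ℝ) + u) :=
    (measurable_extZero hf.ennreal_ofReal).comp (by fun_prop)
  unfold psi psiENN
  rw [ENNReal.ofReal_add h1 h2, mul_comm, ENNReal.ofReal_mul (hK.drift_nonneg _),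
    ofReal_integral_eq_lintegral_ofReal
      (hm.integrableOn hf p fun v _ => abs_zeroExt_le hC hfC _) (.of_forall hnn),
    lintegral_withDensity_tail hK p.incl hm']
  congr 1
  refine setLIntegral_congr_fun measurableSet_Ioi fun v hv => ?_
  rw [ENNReal.ofReal_mul (hz _), ofReal_zeroExt, ENNReal.ofReal_toReal (hK.tail_lt_top _ hv).ne,
    mul_comm]

theorem IsCoefficients.exists_isTailBound (hK : IsCoefficients γ K) (T : ℝ) :
    ∃ m, IsTailBound K T m := by
  obtain ⟨m, h1, h2, h3⟩ := hK.exists_dominating T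
  exact ⟨m, h1, h2, h3⟩

/-- The total mass of `Ψ*ν` is the integral of the bounded function `Ψ 1` against `ν`. -/
theorem IsCoefficients.isFiniteMeasure_psiStarPos (hK : IsCoefficients γ K)
    (ν : Measure (Slab d a b)) [IsFiniteMeasure ν] : IsFiniteMeasure (psiStarPos γ K ν) := by
  obtain ⟨m, hm⟩ := hK.exists_isTailBound (b - a)
  obtain ⟨G, hG⟩ := hK.drift_bounded
  constructor
  rw [← lintegral_one, hK.lintegral_psiStarPos ν measurable_const]
  refine lt_of_le_of_lt (lintegral_mono
    (g := fun _ => ENNReal.ofReal ((G + ∫ v in Ioi (0 : ℝ), m v) * 1)) fun p => ?_) ?_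
  · have h := (hm.ofReal_psi hK (f := fun _ : Slab d a b => 1) measurable_const
      (fun _ => zero_le_one) (C := 1) (fun _ => by simp) p).2
    simp only [ENNReal.ofReal_one] at h
    change psiENN γ K (fun _ => 1) p ≤ _
    rw [← h]
    refine ENNReal.ofReal_le_ofReal ((le_abs_self _).trans (hm.abs_psi_le hK hG (by simp) ?_))
    exact fun v _ => abs_zeroExt_le zero_le_one (fun _ => by simp) _
  · rw [lintegral_const]
    exact ENNReal.mul_lt_top ENNReal.ofReal_lt_top (measure_lt_top _ _)

theorem IsTailBound.psi_sub (hm : IsTailBound K (b - a) m)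
    {f g : Slab d a b → ℝ} (hf : Measurable f) (hg : Measurable g) {C : ℝ}
    (hfC : ∀ p, |f p| ≤ C) (hgC : ∀ p, |g p| ≤ C) (p : Slab d a b) :
    psi γ K (fun p => f p - g p) p = psi γ K f p - psi γ K g p := by
  have hC : 0 ≤ C := (abs_nonneg _).trans (hfC p)
  unfold psi
  simp_rw [zeroExt_sub, sub_mul]
  rw [integral_sub (hm.integrableOn hf p fun v _ => abs_zeroExt_le hC hfC _)
    (hm.integrableOn hg p fun v _ => abs_zeroExt_le hC hgC _)]
  ring

/-- `Ψ*` on positive measures is adjoint to `Ψ` on bounded measurable functions. -/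
theorem IsCoefficients.integral_psiStarPos (hK : IsCoefficients γ K) (ν : Measure (Slab d a b))
    [IsFiniteMeasure ν] {f : Slab d a b → ℝ} (hf : Measurable f) {C : ℝ} (hfC : ∀ p, |f p| ≤ C) :
    Integrable (psi γ K f) ν ∧ Integrable f (psiStarPos γ K ν) ∧
      ∫ p, f p ∂(psiStarPos γ K ν) = ∫ p, psi γ K f p ∂ν := by
  have := hK.isFiniteMeasure_psiStarPos ν
  obtain ⟨m, hm⟩ := hK.exists_isTailBound (b - a)
  obtain ⟨G, hG⟩ := hK.drift_bounded
  have hfint : ∀ {g : Slab d a b → ℝ}, Measurable g → (∀ p, |g p| ≤ C) →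
      Integrable g (psiStarPos γ K ν) := fun hg hgC =>
    Integrable.of_bound hg.aestronglyMeasurable C (.of_forall hgC)
  have key : ∀ {g : Slab d a b → ℝ}, Measurable g → (∀ p, |g p| ≤ C) → (∀ p, 0 ≤ g p) →
      Integrable (psi γ K g) ν ∧ ∫ p, g p ∂(psiStarPos γ K ν) = ∫ p, psi γ K g p ∂ν := by
    intro g hg hgC hg0
    have h := hm.ofReal_psi hK hg hg0 hgC
    have hmeas : Measurable (psi γ K g) := by
      have : psi γ K g = fun p => (psiENN γ K (fun p => ENNReal.ofReal (g p)) p).toReal :=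
        funext fun p => by rw [← (h p).2, ENNReal.toReal_ofReal (h p).1]
      rw [this]
      exact (hK.measurable_psiENN hg.ennreal_ofReal).ennreal_toReal
    refine ⟨Integrable.of_bound hmeas.aestronglyMeasurable ((G + ∫ v in Ioi (0 : ℝ), m v) * C)
      (.of_forall fun p => hm.abs_psi_le hK hG (hgC p) fun v _ =>
        abs_zeroExt_le ((abs_nonneg _).trans (hgC p)) hgC _), ?_⟩
    rw [integral_eq_lintegral_of_nonneg_ae (.of_forall hg0) hg.aestronglyMeasurable,
      integral_eq_lintegral_of_nonneg_ae (.of_forall fun p => (h p).1) hmeas.aestronglyMeasurable,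
      hK.lintegral_psiStarPos ν hg.ennreal_ofReal]
    simp_rw [(h _).2]
  have hpm : Measurable fun p => max (f p) 0 := hf.max measurable_const
  have hnm : Measurable fun p => max (-f p) 0 := hf.neg.max measurable_const
  have hpC : ∀ p, |max (f p) 0| ≤ C := fun p => by
    rw [abs_of_nonneg (le_max_right _ _)]
    exact max_le ((le_abs_self _).trans (hfC p)) ((abs_nonneg _).trans (hfC p))
  have hnC : ∀ p, |max (-f p) 0| ≤ C := fun p => by
    rw [abs_of_nonneg (le_max_right _ _)]
    exact max_le ((neg_le_abs _).trans (hfC p)) ((abs_nonneg _).trans (hfC p))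
  have hsplit : f = fun p => max (f p) 0 - max (-f p) 0 := funext fun p => by
    rcases le_total (f p) 0 with h | h
    · rw [max_eq_right h, max_eq_left (neg_nonneg.2 h)]; ring
    · rw [max_eq_left h, max_eq_right (neg_nonpos.2 h)]; ring
  obtain ⟨hp1, hp2⟩ := key hpm hpC fun p => le_max_right _ _
  obtain ⟨hn1, hn2⟩ := key hnm hnC fun p => le_max_right _ _
  have hpsi : psi γ K f = fun p => psi γ K (fun p => max (f p) 0) p -
      psi γ K (fun p => max (-f p) 0) p := by
    funext p
    conv_lhs => rw [hsplit]
    exact hm.psi_sub hpm hnm hpC hnC p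
  refine ⟨hpsi ▸ hp1.sub hn1, hfint hf hfC, ?_⟩
  rw [hpsi, integral_sub hp1 hn1, ← hp2, ← hn2, ← integral_sub (hfint hpm hpC) (hfint hnm hnC),
    ← hsplit]

theorem IsCoefficients.integral_psiStar (hK : IsCoefficients γ K) (h : SignedMeasure (Slab d a b))
    {f : Slab d a b → ℝ} (hf : Measurable f) {C : ℝ} (hfC : ∀ p, |f p| ≤ C) :
    ∫ᵛ p, f p ∂<•(psiStar γ K h) = ∫ᵛ p, psi γ K f p ∂<•h := by
  have := hK.isFiniteMeasure_psiStarPos h.toJordanDecomposition.posPart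
  have := hK.isFiniteMeasure_psiStarPos h.toJordanDecomposition.negPart
  obtain ⟨hp1, hp2, hp3⟩ := hK.integral_psiStarPos h.toJordanDecomposition.posPart hf hfC
  obtain ⟨hn1, hn2, hn3⟩ := hK.integral_psiStarPos h.toJordanDecomposition.negPart hf hfC
  rw [psiStar, integral_toSigned_sub _ _ hp2 hn2, integral_signed_eq h hp1 hn1, hp3, hn3]

end PsiStar

/-! ### `Ψ` as a bounded operator on `C₀` -/

section PsiOperator

variable {d : ℕ} {a b : ℝ} {γ : Space d × ℝ → ℝ} {K : Space d × ℝ → Measure (Space d × ℝ)}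

theorem isCompact_slab_box (R : ℝ) {c : ℝ} (hc : c < b) :
    IsCompact {p : Slab d a b | ‖p.1‖ ≤ R ∧ (p.2 : ℝ) ≤ c} := by
  have h1 : IsCompact {t : Ico a b | (t : ℝ) ≤ c} := by
    rw [Topology.IsEmbedding.subtypeVal.isCompact_iff]
    have : Subtype.val '' {t : Ico a b | (t : ℝ) ≤ c} = Icc a c := by
      ext t
      constructor
      · rintro ⟨t, ht, rfl⟩
        exact ⟨t.2.1, ht⟩
      · exact fun ht => ⟨⟨t, ht.1, ht.2.trans_lt hc⟩, ht.2, rfl⟩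
    rw [this]
    exact isCompact_Icc
  have h2 := (isCompact_closedBall (0 : Space d) R).prod h1
  convert h2 using 1
  ext p
  simp

/-- Compact subsets of the slab are contained in compact boxes `‖y‖ ≤ R`, `a ≤ t ≤ c` with `c < b`.
-/
theorem tendsto_cocompact_slab_iff {g : Slab d a b → ℝ} :
    Tendsto g (cocompact (Slab d a b)) (𝓝 0) ↔
      ∀ ε > 0, ∃ R, ∃ c < b, ∀ p, ε ≤ |g p| → ‖p.1‖ ≤ R ∧ (p.2 : ℝ) ≤ c := by
  rw [Metric.tendsto_nhds]
  simp only [dist_zero_right, Real.norm_eq_abs]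
  refine forall₂_congr fun ε hε => ?_
  rw [Filter.Eventually, mem_cocompact]
  constructor
  · rintro ⟨S, hS, hSg⟩
    have hmem : ∀ p, ε ≤ |g p| → p ∈ S := fun p hp => by
      by_contra h
      exact absurd (hSg h) (not_lt.2 hp)
    rcases S.eq_empty_or_nonempty with h0 | hne
    · exact ⟨0, b - 1, by linarith, fun p hp => absurd (hmem p hp) (by simp [h0])⟩
    · obtain ⟨p1, -, h1⟩ := hS.exists_isMaxOn hne (f := fun p => ‖p.1‖) (by fun_prop)
      obtain ⟨p2, -, h2⟩ := hS.exists_isMaxOn hne (f := fun p => (p.2 : ℝ)) (by fun_prop)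
      exact ⟨‖p1.1‖, p2.2, p2.2.2.2, fun p hp => ⟨h1 (hmem p hp), h2 (hmem p hp)⟩⟩
  · rintro ⟨R, c, hc, h⟩
    refine ⟨_, isCompact_slab_box R hc, fun p hp => ?_⟩
    by_contra h'
    exact hp (h p (not_lt.1 h'))

/-- Across `b` the extension is continuous because `f` vanishes there; at `a` it may jump, hence the
restriction to `t ≥ a`. -/
theorem continuousOn_zeroExt (f : C₀(Slab d a b, ℝ)) :
    ContinuousOn (zeroExt f) {q : Space d × ℝ | a ≤ q.2} := by
  intro q hq
  by_cases hqb : q.2 < b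
  · rw [← continuousWithinAt_inter (s := {q : Space d × ℝ | a ≤ q.2})
      ((isOpen_lt continuous_snd continuous_const).mem_nhds hqb)]
    have hset : {q : Space d × ℝ | a ≤ q.2} ∩ {q | q.2 < b} = {q | q.2 ∈ Ico a b} := rfl
    rw [hset]
    refine (continuousOn_iff_continuous_domRestrict.2 ?_ : ContinuousOn (zeroExt f) _) q ⟨hq, hqb⟩
    have : domRestrict {q : Space d × ℝ | q.2 ∈ Ico a b} (zeroExt f) =
        fun q => f (q.1.1, ⟨q.1.2, q.2⟩) := by
      funext q
      exact zeroExt_of_mem f q.2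
    rw [this]
    have := f.continuous
    fun_prop
  · have hb : b ≤ q.2 := not_lt.1 hqb
    have h0 : zeroExt f q = 0 := zeroExt_of_notMem f fun h => hqb h.2
    rw [ContinuousWithinAt, h0, Metric.tendsto_nhds]
    intro ε hε
    obtain ⟨R, c, hc, h⟩ := tendsto_cocompact_slab_iff.1 f.zero_at_infty' ε hε
    filter_upwards [mem_nhdsWithin_of_mem_nhds ((isOpen_lt continuous_const continuous_snd).mem_nhds
      (show c < q.2 from hc.trans_le hb))] with r hr
    rw [dist_zero_right, Real.norm_eq_abs]
    by_contra hcon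
    by_cases hrm : r.2 ∈ Ico a b
    · rw [zeroExt_of_mem _ hrm] at hcon
      exact absurd (h _ (not_lt.1 hcon)).2 (not_le.2 hr)
    · rw [zeroExt_of_notMem _ hrm] at hcon
      simp [hε] at hcon

variable {m : ℝ → ℝ}

theorem C₀_abs_le (f : C₀(Slab d a b, ℝ)) (p : Slab d a b) : |f p| ≤ ‖f‖ :=
  f.toBCF.norm_coe_le_norm p

theorem IsTailBound.continuous_psi (hm : IsTailBound K (b - a) m) (hK : IsCoefficients γ K)
    (f : C₀(Slab d a b, ℝ)) : Continuous (psi γ K f) := by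
  have hf := f.continuous
  have hγ := hK.drift_continuous.comp (continuous_incl (d := d) (a := a) (b := b))
  refine (hf.mul hγ).add ?_
  refine continuous_of_dominated (bound := fun v => ‖f‖ * m v)
    (fun p => aestronglyMeasurable_psi_integrand hf.measurable p) (fun p => ?_)
    (hm.integrable.integrableOn.const_mul _) ?_
  · filter_upwards [ae_restrict_mem measurableSet_Ioi] with v hv
    exact hm.norm_le hv (abs_zeroExt_le (norm_nonneg _) (C₀_abs_le f) _)
  · filter_upwards [ae_restrict_mem measurableSet_Ioi] with v hv
    refine Continuous.mul ?_ ((hK.tail_continuous_bounded hv).1.comp continuous_incl)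
    refine (continuousOn_zeroExt f).comp_continuous (by fun_prop) fun p => ?_
    have := p.2.2.1
    have : (0 : ℝ) < v := hv
    simp only [mem_ofPred_eq]
    linarith

theorem IsTailBound.tendsto_psi (hm : IsTailBound K (b - a) m) (hK : IsCoefficients γ K)
    (f : C₀(Slab d a b, ℝ)) : Tendsto (psi γ K f) (cocompact (Slab d a b)) (𝓝 0) := by
  obtain ⟨G, hG⟩ := hK.drift_bounded
  have hG0 : 0 ≤ G := (hK.drift_nonneg 0).trans (hG 0)
  have hM0 : 0 ≤ ∫ v in Ioi (0 : ℝ), m v := integral_nonneg hm.nonneg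
  refine tendsto_cocompact_slab_iff.2 fun ε hε => ?_
  set B := G + ∫ v in Ioi (0 : ℝ), m v with hB
  have hδ : 0 < ε / (B + 1) := by positivity
  obtain ⟨R, c, hc, h⟩ := tendsto_cocompact_slab_iff.1 f.zero_at_infty' _ hδ
  refine ⟨R, c, hc, fun p hp => ?_⟩
  by_contra hcon
  -- A point outside the box has its whole future outside: `y` is unchanged and `t` only grows.
  have h0 : ∀ t : Ico a b, (p.2 : ℝ) ≤ t → |f (p.1, t)| ≤ ε / (B + 1) := fun t ht => by
    by_contra hlt
    have := h (p.1, t) (not_le.1 hlt).le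
    exact hcon ⟨this.1, ht.trans this.2⟩
  have h1 : |psi γ K f p| ≤ B * (ε / (B + 1)) := by
    refine hm.abs_psi_le hK hG (h0 p.2 le_rfl) fun v hv => ?_
    by_cases hq : (p.2 : ℝ) + v ∈ Ico a b
    · rw [zeroExt_of_mem _ hq]
      exact h0 ⟨_, hq⟩ (by simp [hv.le])
    · rw [zeroExt_of_notMem _ hq, abs_zero]
      exact hδ.le
  have h2 : B * (ε / (B + 1)) < ε := by
    rw [mul_div_assoc', div_lt_iff₀ (by positivity)]
    nlinarith
  linarith

theorem IsCoefficients.exists_psi_operator (hK : IsCoefficients γ K) :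
    ∃ Ψ : C₀(Slab d a b, ℝ) →L[ℝ] C₀(Slab d a b, ℝ), ∀ f p, Ψ f p = psi γ K f p := by
  obtain ⟨m, hm⟩ := hK.exists_isTailBound (b - a)
  obtain ⟨G, hG⟩ := hK.drift_bounded
  let L : C₀(Slab d a b, ℝ) →ₗ[ℝ] C₀(Slab d a b, ℝ) :=
    { toFun := fun f => ⟨⟨psi γ K f, hm.continuous_psi hK f⟩, hm.tendsto_psi hK f⟩
      map_add' := fun f g => by
        ext p
        have hadd : ∀ q, zeroExt (f + g : C₀(Slab d a b, ℝ)) q = zeroExt f q + zeroExt g q := by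
          intro q
          by_cases h : q.2 ∈ Ico a b
          · simp [zeroExt_of_mem _ h]
          · simp [zeroExt_of_notMem _ h]
        change psi γ K (f + g : C₀(Slab d a b, ℝ)) p = psi γ K f p + psi γ K g p
        unfold psi
        simp_rw [hadd, add_mul]
        rw [integral_add
          (hm.integrableOn (f := f) (map_continuous f).measurable p fun v _ =>
            abs_zeroExt_le (norm_nonneg _) (C₀_abs_le f) _)
          (hm.integrableOn (f := g) (map_continuous g).measurable p fun v _ =>
            abs_zeroExt_le (norm_nonneg _) (C₀_abs_le g) _), ZeroAtInftyContinuousMap.add_apply]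
        ring
      map_smul' := fun c f => by
        ext p
        have hsmul : ∀ q, zeroExt (c • f : C₀(Slab d a b, ℝ)) q = c * zeroExt f q := by
          intro q
          by_cases h : q.2 ∈ Ico a b
          · simp [zeroExt_of_mem _ h]
          · simp [zeroExt_of_notMem _ h]
        change psi γ K (c • f : C₀(Slab d a b, ℝ)) p = c * psi γ K f p
        unfold psi
        simp_rw [hsmul, mul_assoc]
        rw [integral_const_mul, ZeroAtInftyContinuousMap.smul_apply, smul_eq_mul]
        ring }
  refine ⟨L.mkContinuous (G + ∫ v in Ioi (0 : ℝ), m v) fun f => ?_, fun f p => rfl⟩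
  have hG0 : 0 ≤ G := (hK.drift_nonneg 0).trans (hG 0)
  have hM0 : 0 ≤ ∫ v in Ioi (0 : ℝ), m v := integral_nonneg hm.nonneg
  rw [← ZeroAtInftyContinuousMap.norm_toBCF_eq_norm (f := L f)]
  refine (BoundedContinuousFunction.norm_le (by positivity)).2 fun p => ?_
  exact hm.abs_psi_le hK hG (C₀_abs_le f p) fun v _ =>
    abs_zeroExt_le (norm_nonneg _) (C₀_abs_le f) _

end PsiOperator

/-! ### Convolution with the renewal measures on the slab -/

section Renewal

variable {d : ℕ} {a b : ℝ} {γ : Space d × ℝ → ℝ} {K : Space d × ℝ → Measure (Space d × ℝ)}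
  {γ₀ : Space d → ℝ} {H₀ : Space d → ℝ → ℝ} {V : Space d → Measure ℝ}

/-- Renewal measures depend measurably on the point in space. -/
theorem IsCoefficients.measurable_renewalMeasure (hK : IsCoefficients γ K)
    (hγ₀ : ∀ y t, γ (y, t) = γ₀ y)
    (hH₀ : ∀ y t v, 0 < v → (tail K (y, t) v).toReal = H₀ y v)
    (hH : ∀ y v, 0 < v → 0 ≤ H₀ y v) (hne : ∀ y, 0 < γ₀ y ∨ ∃ v, 0 < v ∧ 0 < H₀ y v)
    (hV : ∀ y, IsRenewalMeasure (γ₀ y) (H₀ y) (V y)) : Measurable V := by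
  refine measurable_of_measurable_lap (fun y => (hV y).Iio_zero)
    (fun y => (hV y).lap_ne_top (hH y) (hne y)) fun l hl => ?_
  simp_rw [fun y => (hV y).lap_eq (hH y) (hne y) hl]
  have hγm : Measurable γ₀ := by
    have : γ₀ = fun y => γ (y, 0) := funext fun y => (hγ₀ y 0).symm
    rw [this]
    exact hK.drift_continuous.measurable.comp measurable_prodMk_right
  have hHm : Measurable fun y => ∫ v in Ioi (0 : ℝ), Real.exp (-l * v) * H₀ y v := by
    have : ∀ y, ∫ v in Ioi (0 : ℝ), Real.exp (-l * v) * H₀ y v =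
        ∫ v in Ioi (0 : ℝ), Real.exp (-l * v) * (posTail K (y, 0) v).toReal := fun y =>
      setIntegral_congr_fun measurableSet_Ioi fun v hv => by
        simp only [posTail_of_pos (mem_Ioi.1 hv), hH₀ y 0 v hv]
    simp_rw [this]
    have hT : Measurable fun x : Space d × ℝ => posTail K (x.1, 0) x.2 :=
      hK.measurable_posTail.comp (g := fun x : (Space d × ℝ) × ℝ => posTail K x.1 x.2)
        (f := fun x : Space d × ℝ => ((x.1, 0), x.2)) (by fun_prop)
    have hg : Measurable fun x : Space d × ℝ =>
        Real.exp (-l * x.2) * (posTail K (x.1, 0) x.2).toReal :=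
      Measurable.mul (by fun_prop) hT.ennreal_toReal
    exact (hg.stronglyMeasurable.integral_prod_right').measurable
  fun_prop

/-- Integration in time: the convolution with Lebesgue measure on `[0, ∞)`. -/
noncomputable def timePrimitive (ν : Measure (Slab d a b)) : Measure (Slab d a b) :=
  timeConv (fun _ => volume.restrict (Ici 0)) ν

theorem isMeasurableFamily_const {α : Type*} [MeasurableSpace α] (μ : Measure ℝ) [SFinite μ] :
    IsMeasurableFamily fun _ : α => μ :=
  fun _ hf => hf.lintegral_prod_right'

theorem lintegral_timePrimitive (ν : Measure (Slab d a b)) {f : Slab d a b → ℝ≥0∞}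
    (hf : Measurable f) : ∫⁻ p, f p ∂(timePrimitive ν) =
      ∫⁻ p, (∫⁻ u in Ici (0 : ℝ), extZero f (p.1, (p.2 : ℝ) + u)) ∂ν :=
  lintegral_timeConv (isMeasurableFamily_const _) ν hf

instance isFiniteMeasure_timePrimitive (ν : Measure (Slab d a b)) [IsFiniteMeasure ν] :
    IsFiniteMeasure (timePrimitive ν) := by
  constructor
  rw [← lintegral_one, lintegral_timePrimitive ν measurable_const]
  -- From a point of the slab, only nonnegative shifts of length at most `b - a` stay inside.
  refine lt_of_le_of_lt (lintegral_mono (g := fun _ => volume (Icc (0 : ℝ) (b - a))) fun p => ?_) ?_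
  · rw [← lintegral_indicator_one measurableSet_Icc, ← lintegral_indicator measurableSet_Ici]
    refine lintegral_mono fun u => ?_
    by_cases hu : (p.2 : ℝ) + u ∈ Ico a b
    · have hpa := p.2.2.1
      by_cases hu0 : 0 ≤ u
      · rw [indicator_of_mem (mem_Ici.2 hu0), indicator_of_mem (mem_Icc.2 ⟨hu0, by linarith [hu.2]⟩)]
        exact (extZero_incl (fun _ : Slab d a b => (1 : ℝ≥0∞)) (p.1, ⟨_, hu⟩)).le
      · rw [indicator_of_notMem (show u ∉ Ici (0 : ℝ) from hu0)]
        exact zero_le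
    · simp [indicator, extZero_of_notMem (fun _ : Slab d a b => (1 : ℝ≥0∞))
        (q := (p.1, (p.2 : ℝ) + u)) hu]
  · rw [lintegral_const]
    exact ENNReal.mul_lt_top (by simp) (measure_lt_top _ _)

theorem timeConv_add {κ : Slab d a b → Measure ℝ} (hκ : IsMeasurableFamily κ)
    (μ ν : Measure (Slab d a b)) : timeConv κ (μ + ν) = timeConv κ μ + timeConv κ ν := by
  refine Measure.ext_of_lintegral _ fun f hf => ?_
  rw [lintegral_add_measure, lintegral_timeConv hκ _ hf, lintegral_timeConv hκ _ hf,
    lintegral_timeConv hκ _ hf, lintegral_add_measure]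

theorem timeConv_mono {κ : Slab d a b → Measure ℝ} (hκ : IsMeasurableFamily κ)
    {μ ν : Measure (Slab d a b)} (h : μ ≤ ν) : timeConv κ μ ≤ timeConv κ ν := by
  refine Measure.le_iff.2 fun s hs => ?_
  rw [← lintegral_indicator_one hs, ← lintegral_indicator_one hs,
    lintegral_timeConv hκ _ (measurable_one.indicator hs),
    lintegral_timeConv hκ _ (measurable_one.indicator hs)]
  exact lintegral_mono' h le_rfl

/-- Convolution with the renewal measure inverts `Ψ*` up to integration in time. -/
theorem IsCoefficients.renewalConvPos_psiStarPos (hK : IsCoefficients γ K)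
    (hγ₀ : ∀ y t, γ (y, t) = γ₀ y)
    (hH₀ : ∀ y t v, 0 < v → (tail K (y, t) v).toReal = H₀ y v)
    (hH : ∀ y v, 0 < v → 0 ≤ H₀ y v) (hne : ∀ y, 0 < γ₀ y ∨ ∃ v, 0 < v ∧ 0 < H₀ y v)
    (hV : ∀ y, IsRenewalMeasure (γ₀ y) (H₀ y) (V y))
    (hfam : IsMeasurableFamily fun p : Slab d a b => V p.1) (ν : Measure (Slab d a b)) :
    renewalConvPos V (psiStarPos γ K ν) = timePrimitive ν := by
  refine Measure.ext_of_lintegral _ fun f hf => ?_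
  set G : Slab d a b → ℝ≥0∞ := fun q => ∫⁻ u, extZero f (q.1, (q.2 : ℝ) + u) ∂(V q.1) with hG
  have hGm : Measurable G := hfam (fun x => extZero f (x.1.1, (x.1.2 : ℝ) + x.2))
    ((measurable_extZero hf).comp (by fun_prop))
  rw [renewalConvPos, lintegral_timeConv hfam _ hf, hK.lintegral_psiStarPos ν hGm,
    lintegral_timePrimitive ν hf]
  refine lintegral_congr fun p => ?_
  have hVs : SFinite (V p.1) := (hV p.1).sFinite (hH p.1) (hne p.1)
  have hTm : Measurable (posTail K p.incl) :=
    hK.measurable_posTail.comp (measurable_prodMk_left (x := p.incl))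
  have hF : Measurable fun s : ℝ => extZero f (p.1, (p.2 : ℝ) + s) :=
    (measurable_extZero hf).comp (by fun_prop)
  have hF2 : Measurable fun x : ℝ =>
      ∫⁻ y, extZero f (p.1, (p.2 : ℝ) + (x + y)) ∂(V p.1) :=
    Measurable.lintegral_prod_right' (f := fun z : ℝ × ℝ => extZero f (p.1, (p.2 : ℝ) + (z.1 + z.2)))
      ((measurable_extZero hf).comp (by fun_prop))
  -- The renewal equation is used over the fixed point `p.1`; the atom and the density of its second
  -- factor produce the two terms of `Ψ`.
  rw [← (hV p.1).conv_eq (hH p.1) (hne p.1) hTm (fun v hv => by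
      rw [posTail_of_pos hv, ← hH₀ p.1 p.2 v hv, ENNReal.ofReal_toReal (hK.tail_lt_top _ hv).ne]
      rfl), Measure.conv_comm, Measure.lintegral_conv hF, lintegral_add_measure,
    lintegral_smul_measure, lintegral_dirac' _ hF2, ← withDensity_tail_eq, psiENN, ← hγ₀ p.1 p.2]
  congr 1
  · simp only [zero_add]
    rfl
  · have hae : ∀ᵐ v ∂((volume.restrict (Ioi (0 : ℝ))).withDensity (tail K p.incl)), 0 < v :=
      (withDensity_absolutelyContinuous _ _).ae_le (ae_restrict_mem measurableSet_Ioi)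
    refine lintegral_congr_ae ?_
    filter_upwards [hae] with v hv
    by_cases hq : (p.2 : ℝ) + v ∈ Ico a b
    · rw [show (p.1, (p.2 : ℝ) + v) = Slab.incl (show Slab d a b from (p.1, ⟨_, hq⟩)) from rfl,
        extZero_incl, hG]
      simp only [add_assoc]
    -- Causality: since `v > 0`, the time `p.2 + v` can only have left the slab through `b`, and a
    -- further shift `u ≥ 0` does not bring it back.
    · rw [extZero_of_notMem _ hq]
      symm
      refine (lintegral_congr_ae (g := fun _ => 0) ?_).trans (by simp)
      filter_upwards [ae_nonneg_of_measure_Iio (hV p.1).Iio_zero] with u hu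
      refine extZero_of_notMem _ fun hmem => hq ⟨?_, ?_⟩
      · linarith [p.2.2.1]
      · linarith [hmem.2]

end Renewal

/-! ### Differences of positive measures and the Jordan decomposition -/

section Jordan

variable {α : Type*} [MeasurableSpace α]

/-- Turns identities of signed measures into identities of sums of positive ones, to which
convolution applies without integrability conditions. -/
theorem toSigned_sub_eq_iff {μ₁ μ₂ ν₁ ν₂ : Measure α} [IsFiniteMeasure μ₁] [IsFiniteMeasure μ₂]
    [IsFiniteMeasure ν₁] [IsFiniteMeasure ν₂] :
    toSigned μ₁ - toSigned μ₂ = toSigned ν₁ - toSigned ν₂ ↔ μ₁ + ν₂ = ν₁ + μ₂ := by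
  rw [toSigned_eq, toSigned_eq, toSigned_eq, toSigned_eq, sub_eq_sub_iff_add_eq_add,
    ← Measure.toSignedMeasure_add, ← Measure.toSignedMeasure_add, Measure.toSignedMeasure_eq_toSignedMeasure_iff]

/-- Minimality of the Jordan decomposition: its parts are the truncated differences `μ - ν` and `ν -
μ`. -/
theorem jordan_posPart_le {h : SignedMeasure α} {μ ν : Measure α} [IsFiniteMeasure μ]
    [IsFiniteMeasure ν] (hh : toSigned μ - toSigned ν = h) :
    h.toJordanDecomposition.posPart ≤ μ ∧ h.toJordanDecomposition.negPart ≤ ν := by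
  rw [← hh, toSigned_eq, toSigned_eq, Measure.toJordanDecomposition_toSignedMeasure_sub]
  exact ⟨Measure.sub_le, Measure.sub_le⟩

end Jordan

/-! ### Distributional time derivatives -/

section TimeDerivative

variable {d : ℕ} {a b : ℝ}

/-- Fubini; integrability on the product follows from the `[0, ∞]`-valued formula applied to `|f|`.
-/
theorem integral_timePrimitive (ν : Measure (Slab d a b)) [IsFiniteMeasure ν]
    {f : Slab d a b → ℝ} (hf : Measurable f) (hfi : Integrable f (timePrimitive ν)) :
    ∫ p, f p ∂(timePrimitive ν) =
      ∫ p, (∫ u in Ici (0 : ℝ), zeroExt f (p.1, (p.2 : ℝ) + u)) ∂ν := by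
  set F : Slab d a b × ℝ → ℝ := fun x => zeroExt f (x.1.1, (x.1.2 : ℝ) + x.2) with hF
  have hFm : Measurable F := (measurable_zeroExt hf).comp (by fun_prop)
  have key : ∀ g : Slab d a b → ℝ, Measurable g →
      ∫⁻ x, ENNReal.ofReal (zeroExt g (x.1.1, (x.1.2 : ℝ) + x.2)) ∂(ν.prod (volume.restrict (Ici (0 : ℝ)))) =
        ∫⁻ p, ENNReal.ofReal (g p) ∂(timePrimitive ν) := by
    intro g hg
    have hgm : Measurable fun x : Slab d a b × ℝ =>
        ENNReal.ofReal (zeroExt g (x.1.1, (x.1.2 : ℝ) + x.2)) :=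
      ((measurable_zeroExt hg).comp (by fun_prop)).ennreal_ofReal
    rw [lintegral_prod _ hgm.aemeasurable, lintegral_timePrimitive ν hg.ennreal_ofReal]
    simp_rw [ofReal_zeroExt]
  have hneg : ∀ q, -zeroExt f q = zeroExt (fun p => -f p) q := fun q => by
    by_cases h : q.2 ∈ Ico a b
    · simp [zeroExt_of_mem _ h]
    · simp [zeroExt_of_notMem _ h]
  have habs : ∀ q, |zeroExt f q| = zeroExt (fun p => |f p|) q := fun q => by
    by_cases h : q.2 ∈ Ico a b
    · simp [zeroExt_of_mem _ h]
    · simp [zeroExt_of_notMem _ h]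
  have hFi : Integrable F (ν.prod (volume.restrict (Ici (0 : ℝ)))) := by
    refine ⟨hFm.aestronglyMeasurable, ?_⟩
    rw [hasFiniteIntegral_iff_norm]
    simp only [hF, Real.norm_eq_abs, habs]
    rw [key _ hf.abs]
    exact (hasFiniteIntegral_iff_norm _).1 hfi.2
  rw [integral_eq_lintegral_pos_part_sub_lintegral_neg_part hfi, ← key f hf,
    ← key (fun p => -f p) hf.neg,
    ← integral_prod F hFi, integral_eq_lintegral_pos_part_sub_lintegral_neg_part hFi]
  simp only [hF, hneg]

theorem deriv_eq_fderiv_time {φ : Space d × ℝ → ℝ} (hφ : ContDiff ℝ ∞ φ) (y : Space d) (t : ℝ) :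
    deriv (fun t => φ (y, t)) t = fderiv ℝ φ (y, t) (0, 1) := by
  have h1 : HasFDerivAt φ (fderiv ℝ φ (y, t)) (y, t) :=
    (hφ.differentiable (by simp)).differentiableAt.hasFDerivAt
  have h2 : HasDerivAt (fun t : ℝ => (y, t)) ((0 : Space d), (1 : ℝ)) t :=
    (hasDerivAt_const t y).prodMk (hasDerivAt_id t)
  exact (h1.comp_hasDerivAt t h2).deriv

theorem integrable_of_continuous_compactSupport {g : Space d × ℝ → ℝ} (hg : Continuous g)
    (hc : HasCompactSupport g) (ν : Measure (Slab d a b)) [IsFiniteMeasure ν] :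
    Integrable (fun p => g p.incl) ν := by
  obtain ⟨C, hC⟩ := hg.bounded_above_of_compact_support hc
  exact Integrable.of_bound (hg.comp continuous_incl).measurable.aestronglyMeasurable C
    (.of_forall fun p => hC _)

theorem continuous_compactSupport_time_deriv {φ : Space d × ℝ → ℝ} (hφ : ContDiff ℝ ∞ φ)
    (hc : HasCompactSupport φ) :
    Continuous (fun q : Space d × ℝ => deriv (fun t => φ (q.1, t)) q.2) ∧
      HasCompactSupport (fun q : Space d × ℝ => deriv (fun t => φ (q.1, t)) q.2) := by
  have h : (fun q : Space d × ℝ => deriv (fun t => φ (q.1, t)) q.2) =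
      fun q => fderiv ℝ φ q (0, 1) := funext fun q => deriv_eq_fderiv_time hφ q.1 q.2
  rw [h]
  exact ⟨(hφ.continuous_fderiv (by simp)).clm_apply continuous_const,
    hc.fderiv_apply (𝕜 := ℝ) (0, 1)⟩

/-- The time primitive of a measure has that measure as its time derivative. -/
theorem integral_deriv_timePrimitive (ν : Measure (Slab d a b)) [IsFiniteMeasure ν]
    {φ : Space d × ℝ → ℝ} (hφ : ContDiff ℝ ∞ φ) (hc : HasCompactSupport φ)
    (hb : tsupport φ ⊆ {q | q.2 < b}) :
    ∫ p : Slab d a b, deriv (fun t => φ (p.1, t)) p.2 ∂(timePrimitive ν) =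
      -∫ p, φ p.incl ∂ν := by
  obtain ⟨hd1, hd2⟩ := continuous_compactSupport_time_deriv hφ hc
  rw [integral_timePrimitive ν (f := fun p : Slab d a b => deriv (fun t => φ (p.1, t)) p.2)
    (hd1.comp continuous_incl).measurable
    (integrable_of_continuous_compactSupport hd1 hd2 (timePrimitive ν)), ← integral_neg (fun p : Slab d a b => φ p.incl)]
  refine integral_congr_ae (.of_forall fun p => ?_)
  simp only
  set ψ : ℝ → ℝ := fun u => φ (p.1, (p.2 : ℝ) + u) with hψ
  have hψd : ContDiff ℝ 1 ψ := (hφ.of_le (by simp)).comp (by fun_prop)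
  have hemb : IsClosedEmbedding fun u : ℝ => (p.1, (p.2 : ℝ) + u) := by
    refine Isometry.isClosedEmbedding (Isometry.of_dist_eq fun u v => ?_)
    simp [Prod.dist_eq]
  have hψc : HasCompactSupport ψ := hc.comp_isClosedEmbedding hemb
  -- The fundamental theorem of calculus on the half-line starting at `p`; compact support kills the
  -- term at infinity.
  have h := hψc.integral_Ioi_deriv_eq hψd 0
  rw [← restrict_Ioi_eq_restrict_Ici]
  have h0 : ψ 0 = φ p.incl := by simp [hψ, Slab.incl]
  rw [← h0, ← h]
  refine setIntegral_congr_fun measurableSet_Ioi fun u hu => ?_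
  have hu0 : (0 : ℝ) < u := hu
  have hder : deriv ψ u = deriv (fun t => φ (p.1, t)) ((p.2 : ℝ) + u) :=
    deriv_comp_const_add (fun t => φ (p.1, t)) (p.2 : ℝ) u
  simp only [hder]
  by_cases hq : (p.2 : ℝ) + u ∈ Ico a b
  · rw [zeroExt_of_mem _ hq]
  -- The zero extension agrees with the true derivative: a later time outside the slab is `≥ b`, off
  -- the support of `φ`.
  · rw [zeroExt_of_notMem _ hq, deriv_eq_fderiv_time hφ]
    have hnot : (p.1, (p.2 : ℝ) + u) ∉ tsupport φ := fun hmem =>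
      hq ⟨by linarith [p.2.2.1], hb hmem⟩
    have := image_eq_zero_of_notMem_tsupport (f := fderiv ℝ φ)
      (fun hmem => hnot (tsupport_fderiv_subset ℝ hmem))
    rw [this]
    rfl

theorem isTimeDerivative_timePrimitive (g : SignedMeasure (Slab d a b)) :
    IsTimeDerivative (toSigned (timePrimitive g.toJordanDecomposition.posPart) -
      toSigned (timePrimitive g.toJordanDecomposition.negPart)) g := by
  intro φ hφ hc hb
  obtain ⟨hd1, hd2⟩ := continuous_compactSupport_time_deriv hφ hc
  rw [integral_signed_eq g (integrable_of_continuous_compactSupport hφ.continuous hc _)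
      (integrable_of_continuous_compactSupport hφ.continuous hc _),
    integral_toSigned_sub _ _ (f := fun p : Slab d a b => deriv (fun t => φ (p.1, t)) p.2)
      (integrable_of_continuous_compactSupport hd1 hd2 _)
      (integrable_of_continuous_compactSupport hd1 hd2 _),
    integral_deriv_timePrimitive _ hφ hc hb, integral_deriv_timePrimitive _ hφ hc hb]
  ring

/-- Finite measures on the slab are determined by test functions. -/
theorem measure_slab_ext {P Q : Measure (Slab d a b)} [IsFiniteMeasure P] [IsFiniteMeasure Q]
    (h : ∀ φ : Space d × ℝ → ℝ, ContDiff ℝ ∞ φ → HasCompactSupport φ → tsupport φ ⊆ {q | q.2 < b} →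
      ∫ p, φ p.incl ∂P = ∫ p, φ p.incl ∂Q) : P = Q := by
  -- In the whole space `t = a` is no longer a boundary, so test functions also detect mass at `t =
  -- a`.
  set P' := P.map Slab.incl with hP'
  set Q' := Q.map Slab.incl with hQ'
  have hfP : IsFiniteMeasure P' := Measure.isFiniteMeasure_map P _
  have hfQ : IsFiniteMeasure Q' := Measure.isFiniteMeasure_map Q _
  -- Both measures have densities with respect to `ρ`, so the claim becomes that an integrable
  -- function annihilated by all test functions supported in `{t < b}` vanishes almost everywhere
  -- there.
  set ρ := P' + Q' with hρ
  have hPρ : P' ≪ ρ := Measure.absolutelyContinuous_of_le (Measure.le_add_right le_rfl)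
  have hQρ : Q' ≪ ρ := Measure.absolutelyContinuous_of_le (Measure.le_add_left le_rfl)
  have hD : Integrable (fun q => (P'.rnDeriv ρ q).toReal - (Q'.rnDeriv ρ q).toReal) ρ :=
    Measure.integrable_toReal_rnDeriv.sub Measure.integrable_toReal_rnDeriv
  have hU : IsOpen {q : Space d × ℝ | q.2 < b} := isOpen_lt continuous_snd continuous_const
  have hae := hU.ae_eq_zero_of_integral_contDiff_smul_eq_zero (μ := ρ)
    (hD.locallyIntegrable.locallyIntegrableOn _) fun φ hφ hc hb => by
      obtain ⟨C, hC⟩ := hφ.continuous.bounded_above_of_compact_support hc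
      have hi : ∀ R : Measure (Space d × ℝ), IsFiniteMeasure R →
          Integrable (fun q => (R.rnDeriv ρ q).toReal • φ q) ρ := fun R _ => by
        refine Integrable.mul_bdd (c := C) Measure.integrable_toReal_rnDeriv
          hφ.continuous.aestronglyMeasurable (.of_forall hC)
      have h1 : ∀ q, φ q • ((P'.rnDeriv ρ q).toReal - (Q'.rnDeriv ρ q).toReal) =
          (P'.rnDeriv ρ q).toReal • φ q - (Q'.rnDeriv ρ q).toReal • φ q := fun q => by
        simp only [smul_eq_mul]
        ring
      simp_rw [h1]
      rw [integral_sub (hi P' hfP) (hi Q' hfQ), integral_rnDeriv_smul hPρ, integral_rnDeriv_smul hQρ,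
        hP', hQ', measurableEmbedding_incl.integral_map, measurableEmbedding_incl.integral_map,
        h φ hφ hc hb, sub_self]
  have hmem : ∀ᵐ q ∂ρ, q.2 < b := by
    have hm : ∀ R : Measure (Slab d a b), ∀ᵐ q ∂(R.map Slab.incl), q.2 < b := fun R => by
      rw [measurableEmbedding_incl.ae_map_iff]
      exact .of_forall fun p => p.2.2.2
    rw [hρ, ae_add_measure_iff]
    exact ⟨hm P, hm Q⟩
  have hrn : P'.rnDeriv ρ =ᵐ[ρ] Q'.rnDeriv ρ := by
    filter_upwards [hae, hmem, Measure.rnDeriv_ne_top P' ρ, Measure.rnDeriv_ne_top Q' ρ]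
      with q h1 h2 h3 h4
    exact (ENNReal.toReal_eq_toReal_iff' h3 h4).1 (sub_eq_zero.1 (h1 h2))
  have hPQ : P' = Q' := by
    rw [← Measure.withDensity_rnDeriv_eq P' ρ hPρ, ← Measure.withDensity_rnDeriv_eq Q' ρ hQρ,
      withDensity_congr_ae hrn]
  rw [← measurableEmbedding_incl.comap_map P, ← measurableEmbedding_incl.comap_map Q]
  exact congrArg _ hPQ

/-- Both measures have the same integrals against all test functions. Moving negative parts across
reduces the claim to `measure_slab_ext`. -/
theorem IsTimeDerivative.unique {μ g₁ g₂ : SignedMeasure (Slab d a b)}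
    (h₁ : IsTimeDerivative μ g₁) (h₂ : IsTimeDerivative μ g₂) : g₁ = g₂ := by
  rw [← toSigned_jordan g₁, ← toSigned_jordan g₂, toSigned_sub_eq_iff]
  refine measure_slab_ext fun φ hφ hc hb => ?_
  have hi : ∀ (R : Measure (Slab d a b)) [IsFiniteMeasure R], Integrable (fun p => φ p.incl) R :=
    fun R _ => integrable_of_continuous_compactSupport hφ.continuous hc R
  have h := (h₁ φ hφ hc hb).trans (h₂ φ hφ hc hb).symm
  rw [integral_signed_eq g₁ (hi _) (hi _), integral_signed_eq g₂ (hi _) (hi _)] at h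
  rw [integral_add_measure (hi _) (hi _), integral_add_measure (hi _) (hi _)]
  linarith

end TimeDerivative

/-! ### Inversion of `Ψ*` -/

section Inverse

variable {d : ℕ} {a b : ℝ} {γ : Space d × ℝ → ℝ} {K : Space d × ℝ → Measure (Space d × ℝ)}
  {γ₀ : Space d → ℝ} {H₀ : Space d → ℝ → ℝ} {V : Space d → Measure ℝ}

/-- Convolution with `V` maps `Ψ*g±` to the time primitives of `g±`. These dominate `V ⋆ h±`, and
their difference is `V ⋆ h`. -/
theorem IsCoefficients.renewalConv_psiStar (hK : IsCoefficients γ K)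
    (hγ₀ : ∀ y t, γ (y, t) = γ₀ y)
    (hH₀ : ∀ y t v, 0 < v → (tail K (y, t) v).toReal = H₀ y v)
    (hH : ∀ y v, 0 < v → 0 ≤ H₀ y v) (hne : ∀ y, 0 < γ₀ y ∨ ∃ v, 0 < v ∧ 0 < H₀ y v)
    (hV : ∀ y, IsRenewalMeasure (γ₀ y) (H₀ y) (V y)) {g h : SignedMeasure (Slab d a b)}
    (hgh : psiStar γ K g = h) :
    IsFiniteMeasure (renewalConvPos V h.toJordanDecomposition.posPart) ∧
      IsFiniteMeasure (renewalConvPos V h.toJordanDecomposition.negPart) ∧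
      IsTimeDerivative (renewalConv V h) g := by
  have hVm := hK.measurable_renewalMeasure hγ₀ hH₀ hH hne hV
  have hfam : IsMeasurableFamily fun p : Slab d a b => V p.1 :=
    isMeasurableFamily_of_lap (hVm.comp measurable_fst)
      fun p => (hV p.1).lap_ne_top (hH p.1) (hne p.1)
  have hinv := hK.renewalConvPos_psiStarPos hγ₀ hH₀ hH hne hV hfam
  have hA := hK.isFiniteMeasure_psiStarPos g.toJordanDecomposition.posPart
  have hB := hK.isFiniteMeasure_psiStarPos g.toJordanDecomposition.negPart
  obtain ⟨hle1, hle2⟩ := jordan_posPart_le hgh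
  have hf1 : IsFiniteMeasure (renewalConvPos V h.toJordanDecomposition.posPart) :=
    isFiniteMeasure_of_le (timePrimitive g.toJordanDecomposition.posPart)
      ((timeConv_mono hfam hle1).trans_eq (hinv _))
  have hf2 : IsFiniteMeasure (renewalConvPos V h.toJordanDecomposition.negPart) :=
    isFiniteMeasure_of_le (timePrimitive g.toJordanDecomposition.negPart)
      ((timeConv_mono hfam hle2).trans_eq (hinv _))
  refine ⟨hf1, hf2, ?_⟩
  -- `h⁺ + Ψ*g⁻ = Ψ*g⁺ + h⁻`, an identity of positive measures that can be convolved with `V`.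
  have hsum := toSigned_sub_eq_iff.1 ((toSigned_jordan h).trans hgh.symm)
  have hconv := congrArg (timeConv fun p : Slab d a b => V p.1) hsum
  rw [timeConv_add hfam, timeConv_add hfam] at hconv
  have heq : renewalConv V h = toSigned (timePrimitive g.toJordanDecomposition.posPart) -
      toSigned (timePrimitive g.toJordanDecomposition.negPart) := by
    rw [renewalConv, toSigned_sub_eq_iff, ← hinv, ← hinv]
    exact hconv
  rw [heq]
  exact isTimeDerivative_timePrimitive g

end Inverse

end CTRW

/-! ### The main theorem -/

theorem mainTheorem5 (d : ℕ) (a b : ℝ) (hab : a < b)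
    (γ : CTRW.Space d × ℝ → ℝ) (K : CTRW.Space d × ℝ → Measure (CTRW.Space d × ℝ))
    (hK : CTRW.IsCoefficients γ K)
    -- the drift and the Lévy tail do not depend on time
    (γ₀ : CTRW.Space d → ℝ) (H₀ : CTRW.Space d → ℝ → ℝ)
    (hγ₀ : ∀ y t, γ (y, t) = γ₀ y)
    (hH₀ : ∀ y t v, 0 < v → (CTRW.tail K (y, t) v).toReal = H₀ y v)
    -- no subordinator with drift `γ₀ y` and tail `H₀ y` is identically zero
    (hne : ∀ y, 0 < γ₀ y ∨ ∃ v, 0 < v ∧ 0 < H₀ y v) :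
    -- `psi` is a bounded operator on `C₀(ℝ^d × [a, b))` and `psiStar` is its adjoint
    (∃ Ψ : C₀(CTRW.Slab d a b, ℝ) →L[ℝ] C₀(CTRW.Slab d a b, ℝ),
      (∀ f p, Ψ f p = CTRW.psi γ K f p) ∧
      ∀ (h : SignedMeasure (CTRW.Slab d a b)) (f : C₀(CTRW.Slab d a b, ℝ)),
        ∫ᵛ p, f p ∂<•(CTRW.psiStar γ K h) = ∫ᵛ p, Ψ f p ∂<•h) ∧
    -- `psiStar` is one-to-one
    Function.Injective
      (CTRW.psiStar γ K : SignedMeasure (CTRW.Slab d a b) → SignedMeasure (CTRW.Slab d a b)) ∧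
    -- the renewal measures exist
    (∀ y, ∃ V : Measure ℝ, CTRW.IsRenewalMeasure (γ₀ y) (H₀ y) V) ∧
    ∀ V : CTRW.Space d → Measure ℝ, (∀ y, CTRW.IsRenewalMeasure (γ₀ y) (H₀ y) (V y)) →
      Measurable V ∧
      -- their Laplace transforms
      (∀ y l, 0 < l →
        IntegrableOn (fun t => Real.exp (-l * t)) (Ici 0) (V y) ∧
        ∫ t in Ici (0 : ℝ), Real.exp (-l * t) ∂(V y) =
          1 / l * (1 / (γ₀ y + ∫ v in Ioi (0 : ℝ), Real.exp (-l * v) * H₀ y v))) ∧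
      -- for `h` in the range, the measure `V ⋆ h` is finite and the preimage of `h` is `d/dt (V ⋆ h)`
      ∀ h ∈ Set.range (CTRW.psiStar γ K : SignedMeasure (CTRW.Slab d a b) → _),
        IsFiniteMeasure (CTRW.renewalConvPos V h.toJordanDecomposition.posPart) ∧
        IsFiniteMeasure (CTRW.renewalConvPos V h.toJordanDecomposition.negPart) ∧
        ∀ g : SignedMeasure (CTRW.Slab d a b),
          CTRW.psiStar γ K g = h ↔ CTRW.IsTimeDerivative (CTRW.renewalConv V h) g := by

  have hH : ∀ y v, 0 < v → 0 ≤ H₀ y v := fun y v hv => by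
    rw [← hH₀ y 0 v hv]
    exact ENNReal.toReal_nonneg
  have hex : ∀ y, ∃ V : Measure ℝ, CTRW.IsRenewalMeasure (γ₀ y) (H₀ y) V := fun y => by
    rw [← hγ₀ y 0]
    exact hK.exists_isRenewalMeasure (y, 0) (hH₀ y 0)
  refine ⟨?_, ?_, hex, fun V hV => ⟨hK.measurable_renewalMeasure hγ₀ hH₀ hH hne hV,
    fun y l hl => (hV y).integral_exp (hH y) (hne y) hl, ?_⟩⟩
  · obtain ⟨Ψ, hΨ⟩ := hK.exists_psi_operator (a := a) (b := b)
    refine ⟨Ψ, hΨ, fun h f => ?_⟩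
    rw [hK.integral_psiStar h (map_continuous f).measurable (CTRW.C₀_abs_le f)]
    simp_rw [hΨ]
  · choose V hV using hex
    -- Both `g₁` and `g₂` are the time derivative of `V ⋆ Ψ*g₂`.
    intro g₁ g₂ hg
    exact (hK.renewalConv_psiStar hγ₀ hH₀ hH hne hV hg).2.2.unique
      (hK.renewalConv_psiStar hγ₀ hH₀ hH hne hV rfl).2.2
  · rintro h ⟨g₀, hg₀⟩
    obtain ⟨h1, h2, h3⟩ := hK.renewalConv_psiStar hγ₀ hH₀ hH hne hV hg₀
    -- For the converse, any time derivative of `V ⋆ h` equals the known preimage `g₀` by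
    -- uniqueness.
    exact ⟨h1, h2, fun g => ⟨fun hg => (hK.renewalConv_psiStar hγ₀ hH₀ hH hne hV hg).2.2,
      fun hg => hg.unique h3 ▸ hg₀⟩⟩
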